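/- Let $\mathbb K\in\{\mathbb R,\mathbb C\}$; all Banach spaces are over $\mathbb K$. For a separable Banach space $X$, let $\mathcal{SB}(X)$ be the set of infinite-dimensional closed linear subspaces of $X$, with the relative Effros Borel structure, i.e. the $\sigma$-algebra generated by the sets $\{Y\in\mathcal{SB}(X): Y\cap U\neq\emptyset\}$, $U\subseteq X$ open. A separable Banach space $X$ is called ergodic if there is a Borel map $\phi:2^{\mathbb N}\to\mathcal{SB}(X)$ such that, for all $x,y\in 2^{\mathbb N}$, one has $x(n)=y(n)$ for all sufficiently large $n$ if and only if $\phi(x)$ and $\phi(y)$ are linearly homeomorphic. A Banach space $Z$ is crudely finitely representable in a Banach space $X$ if there is a constant $K>0$ such that for every finite-dimensional subspace $F$ of $Z$ there is a linear isomorphism $T$ from $F$ onto a subspace $T(F)$ of $X$ with $\|T\|\,\|T^{-1}\|\le K$. If $X$ is a separable Banach space in which $\ell_p$ is crudely finitely representable for some $2<p\le\infty$, then $X$ is ergodic. In particular, $\ell_p$ is ergodic for $2<p<\infty$. -/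

import Mathlib

open scoped ENNReal

/-- The Effros Borel structure on the closed subsets of `X`: the `σ`-algebra generated by the sets
`{F | F ∩ U ≠ ∅}`, with `U ⊆ X` open. -/
@[reducible]
def effrosBorel (X : Type*) [TopologicalSpace X] :
    MeasurableSpace (TopologicalSpace.Closeds X) :=
  MeasurableSpace.generateFrom
    {A | ∃ U : Set X, IsOpen U ∧
      A = {F : TopologicalSpace.Closeds X | ((F : Set X) ∩ U).Nonempty}}

/-- `SB 𝕜 X` is the set of infinite-dimensional closed linear subspaces of `X`. -/
def SB (𝕜 X : Type*) [RCLike 𝕜] [NormedAddCommGroup X] [NormedSpace 𝕜 X] : Type _ :=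
  {Y : ClosedSubmodule 𝕜 X // ¬ FiniteDimensional 𝕜 Y.toSubmodule}

/-- `SB 𝕜 X` carries the relative Effros Borel structure. -/
instance SB.instMeasurableSpace (𝕜 X : Type*) [RCLike 𝕜] [NormedAddCommGroup X]
    [NormedSpace 𝕜 X] : MeasurableSpace (SB 𝕜 X) :=
  MeasurableSpace.comap (fun Y : SB 𝕜 X => Y.1.toCloseds) (effrosBorel X)

/-- Linear homeomorphism between infinite-dimensional closed subspaces of `X`. -/
def SB.Isomorphic {𝕜 X : Type*} [RCLike 𝕜] [NormedAddCommGroup X] [NormedSpace 𝕜 X]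
    (Y Z : SB 𝕜 X) : Prop :=
  Nonempty (Y.1.toSubmodule ≃L[𝕜] Z.1.toSubmodule)

/-- The relation of eventual agreement on the Cantor space. -/
def EventualAgreement (x y : ℕ → Bool) : Prop :=
  ∃ N : ℕ, ∀ n, N ≤ n → x n = y n

/-- Borel reducibility of the relation `R` on `α` to the relation `S` on `β`. -/
def BorelReducible {α β : Type*} [MeasurableSpace α] [MeasurableSpace β]
    (R : α → α → Prop) (S : β → β → Prop) : Prop :=
  ∃ φ : α → β, Measurable φ ∧ ∀ x y, R x y ↔ S (φ x) (φ y)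

/-- A Banach space is ergodic if it is separable and eventual agreement on the Cantor space is
Borel reducible to isomorphism between its infinite-dimensional closed subspaces. -/
def IsErgodicSpace (𝕜 X : Type*) [RCLike 𝕜] [NormedAddCommGroup X] [NormedSpace 𝕜 X]
    [CompleteSpace X] : Prop :=
  TopologicalSpace.SeparableSpace X ∧
    BorelReducible EventualAgreement (SB.Isomorphic (𝕜 := 𝕜) (X := X))

/-- `X` is `K`-crudely finitely representable in `Y`. -/
def CrudelyFinitelyRepresentableWith (𝕜 X Y : Type*) [RCLike 𝕜]
    [NormedAddCommGroup X] [NormedSpace 𝕜 X] [NormedAddCommGroup Y] [NormedSpace 𝕜 Y]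
    (K : ℝ) : Prop :=
  ∀ F : Submodule 𝕜 X, FiniteDimensional 𝕜 F →
    ∃ (G : Submodule 𝕜 Y) (T : F ≃L[𝕜] G),
      ‖(T : F →L[𝕜] G)‖ * ‖(T.symm : G →L[𝕜] F)‖ ≤ K

/-- `X` is crudely finitely representable in `Y`. -/
def CrudelyFinitelyRepresentable (𝕜 X Y : Type*) [RCLike 𝕜]
    [NormedAddCommGroup X] [NormedSpace 𝕜 X] [NormedAddCommGroup Y] [NormedSpace 𝕜 Y] : Prop :=
  ∃ K : ℝ, 0 < K ∧ CrudelyFinitelyRepresentableWith 𝕜 X Y K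

/-!
A copy of `ℓ_p ^ m` in `X` is flat: each of its coordinates extends to `X` with norm at most a
constant, while the norm of a vector with entries in the unit disc is at most a constant times
`m ^ (1 / p)`. By crude finite representability `X` contains a sequence of such copies, with
dimensions growing geometrically, in which every coordinate vanishes on the other copies. On sets of
`m` elements there are systems of orthogonal sign functions (Walsh functions multiplied by random
signs) whose averaged correlations are of order `log m / √m`; since `p > 2`, this is summable even
after multiplication by `m ^ (1 / p)`.

A point `x` of the Cantor space determines the closed span of vectors that join a function on the
`n`-th copy to a function on the next one, the digit `x n` selecting one of two uncorrelated systems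
for the latter. The normalized trace of an operator between two such spaces can be computed at level
`n` in either of the two copies, so it changes by a summable amount from one level to the next as
long as the digits agree, and it is small at the first level where they differ.

If isomorphisms with uniformly bounded norms, one from the space of `x` to that of `y` and one from
the space of `x'` to that of a point very close to `y`, nearly agree on one level, then composing
one with the inverse of the other gives an operator with trace near `1` at that level, which is
impossible if `x` and `x'` first differ further on. Hence isomorphism is covered by countably many
nowhere dense relations, so a continuous map of the Cantor space into itself can preserve eventual
agreement and send points that do not eventually agree to nonisomorphic spaces. Conversely, changing
finitely many digits of `x` changes its space only by an isomorphism.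
-/

theorem sum_exp_mul_of_abs_eq_one {S : Type*} [Fintype S] {φ : S → ℝ} (hφ : ∀ s, |φ s| = 1)
    (hsum : ∑ s, φ s = 0) (c : ℝ) :
    ∑ s, Real.exp (c * φ s) = Fintype.card S * Real.cosh c := by
  have hexp : ∀ s, Real.exp (c * φ s) = Real.cosh c + φ s * Real.sinh c := by
    intro s
    rcases eq_or_eq_neg_of_abs_eq (hφ s) with h | h <;> rw [h]
    · rw [mul_one, one_mul, Real.cosh_add_sinh]
    · rw [mul_neg_one, neg_one_mul, ← sub_eq_add_neg, Real.cosh_sub_sinh]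
  simp_rw [hexp, Finset.sum_add_distrib, ← Finset.sum_mul, hsum, zero_mul, add_zero,
    Finset.sum_const, Finset.card_univ, nsmul_eq_mul]

theorem sum_exp_mul_sum_le {I S : Type*} [Fintype I] [DecidableEq I] [Fintype S] {φ : I → S → ℝ}
    (hφ : ∀ i s, |φ i s| = 1) (hsum : ∀ i, ∑ s, φ i s = 0) (c : ℝ) :
    ∑ s : I → S, Real.exp (c * ∑ i, φ i (s i)) ≤
      Fintype.card (I → S) * Real.exp (Fintype.card I * (c ^ 2 / 2)) := by
  calc ∑ s : I → S, Real.exp (c * ∑ i, φ i (s i))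
      = ∏ i, ∑ s, Real.exp (c * φ i s) := by
        simp_rw [Finset.mul_sum, Real.exp_sum, Fintype.prod_sum]
    _ = (Fintype.card S * Real.cosh c) ^ Fintype.card I := by
        simp_rw [sum_exp_mul_of_abs_eq_one (hφ _) (hsum _), Finset.prod_const, Finset.card_univ]
    _ ≤ Fintype.card (I → S) * Real.exp (Fintype.card I * (c ^ 2 / 2)) := by
        rw [mul_pow, Fintype.card_fun, Nat.cast_pow, Real.exp_nat_mul]
        gcongr
        exact Real.cosh_le_exp_half_sq c

theorem log_natCast_le_of_le_two_pow {N k : ℕ} (h : N ≤ 2 ^ k) : Real.log N ≤ k := by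
  rcases N.eq_zero_or_pos with rfl | hN
  · simp
  calc Real.log N ≤ Real.log (2 ^ k) := Real.log_le_log (by exact_mod_cast hN) (by exact_mod_cast h)
    _ = k * Real.log 2 := Real.log_pow _ _
    _ ≤ k := mul_le_of_le_one_right k.cast_nonneg (Real.log_two_lt_d9.le.trans (by norm_num))

/-- Exponential moments, as in the proof of Hoeffding's inequality, followed by a union bound. -/
theorem exists_forall_abs_sum_le {I S K : Type*} [Fintype I] [Nonempty I] [Fintype S] [Nonempty S]
    [Fintype K] (φ : K → I → S → ℝ) (hφ : ∀ k i s, |φ k i s| = 1)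
    (hsum : ∀ k i, ∑ s, φ k i s = 0) :
    ∃ s : I → S, ∀ k, |∑ i, φ k i (s i)| ≤
      √(Fintype.card I) * (Real.log (2 * Fintype.card K) + 1 / 2) := by
  classical
  set m : ℝ := (Fintype.card I : ℝ)
  have hm : 0 < √m := Real.sqrt_pos.2 (Nat.cast_pos.2 Fintype.card_pos)
  set l : ℝ := (√m)⁻¹
  have hl : m * (l ^ 2 / 2) = 1 / 2 := by
    rw [inv_pow, Real.sq_sqrt (Real.sqrt_pos.1 hm).le, ← mul_div_assoc,
      mul_inv_cancel₀ (Real.sqrt_pos.1 hm).ne']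
  have htotal : ∑ s : I → S, ∑ k, Real.exp |l * ∑ i, φ k i (s i)| ≤
      ∑ _s : I → S, 2 * Fintype.card K * Real.exp (1 / 2) := by
    rw [Finset.sum_comm]
    calc ∑ k, ∑ s : I → S, Real.exp |l * ∑ i, φ k i (s i)|
        ≤ ∑ k : K, ∑ s : I → S, (Real.exp (l * ∑ i, φ k i (s i)) +
            Real.exp (-l * ∑ i, φ k i (s i))) := by
          gcongr with k _ s
          rw [neg_mul]
          exact Real.exp_abs_le _
      _ ≤ ∑ _k : K, (Fintype.card (I → S) * Real.exp (m * (l ^ 2 / 2)) +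
            Fintype.card (I → S) * Real.exp (m * ((-l) ^ 2 / 2))) := by
          simp_rw [Finset.sum_add_distrib (s := (Finset.univ : Finset (I → S)))]
          gcongr with k <;> exact sum_exp_mul_sum_le (hφ k) (hsum k) _
      _ = ∑ _s : I → S, 2 * Fintype.card K * Real.exp (1 / 2) := by
          simp only [neg_sq, hl, Finset.sum_const, Finset.card_univ, nsmul_eq_mul]
          ring
  obtain ⟨s, -, hs⟩ := Finset.exists_le_of_sum_le Finset.univ_nonempty htotal
  refine ⟨s, fun k => ?_⟩
  have hK : (0 : ℝ) < 2 * Fintype.card K :=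
    mul_pos two_pos (Nat.cast_pos.2 (Fintype.card_pos_iff.2 ⟨k⟩))
  have hk : Real.exp |l * ∑ i, φ k i (s i)| ≤
      Real.exp (Real.log (2 * Fintype.card K) + 1 / 2) := by
    rw [Real.exp_add, Real.exp_log hK]
    exact (Finset.single_le_sum (f := fun k => Real.exp |l * ∑ i, φ k i (s i)|)
      (fun _ _ => (Real.exp_pos _).le) (Finset.mem_univ k)).trans hs
  rwa [Real.exp_le_exp, abs_mul, abs_of_pos (inv_pos.2 hm), inv_mul_le_iff₀ hm] at hk

/-- The Walsh function `s ↦ (-1) ^ (A ⬝ᵥ s)` on the Boolean cube, indexed by the vector `A`. -/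
noncomputable def walsh {ι : Type*} [Fintype ι] (A s : ι → ZMod 2) : ℝ :=
  AddChar.zmodChar 2 (ζ := (-1 : ℝ)) (by norm_num) (A ⬝ᵥ s)

section Walsh

variable {ι : Type*} [Fintype ι]

theorem walsh_comm (A s : ι → ZMod 2) : walsh A s = walsh s A := by
  rw [walsh, walsh, dotProduct_comm]

theorem walsh_add_left (A B s : ι → ZMod 2) : walsh (A + B) s = walsh A s * walsh B s := by
  rw [walsh, add_dotProduct, AddChar.map_add_eq_mul, walsh, walsh]

theorem walsh_zero_left (s : ι → ZMod 2) : walsh 0 s = 1 := by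
  rw [walsh, zero_dotProduct, AddChar.map_zero_eq_one]

theorem abs_walsh (A s : ι → ZMod 2) : |walsh A s| = 1 := by
  rw [walsh, AddChar.zmodChar_apply, abs_neg_one_pow]

theorem walsh_mul_self (A s : ι → ZMod 2) : walsh A s * walsh A s = 1 := by
  rw [← abs_mul_abs_self, abs_walsh, one_mul]

theorem sum_walsh_of_ne_zero [DecidableEq ι] {A : ι → ZMod 2} (hA : A ≠ 0) :
    ∑ s, walsh A s = 0 := by
  obtain ⟨k, hk⟩ := Function.ne_iff.1 hA
  have hk1 : A k = 1 := (by decide : ∀ c : ZMod 2, c ≠ 0 → c = 1) _ hk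
  have hflip : ∀ s, walsh A (Pi.single k 1 + s) = -walsh A s := by
    intro s
    rw [walsh_comm, walsh_add_left, walsh_comm _ A, walsh_comm s A, walsh, dotProduct_single, hk1]
    simp [AddChar.zmodChar_apply, ZMod.val_one]
  have h := Fintype.sum_equiv (Equiv.addLeft (Pi.single k 1)) _ _ fun s => (hflip s).symm
  rw [Finset.sum_neg_distrib] at h
  linarith

theorem sum_walsh_mul_walsh [DecidableEq ι] (i j : ι → ZMod 2) :
    ∑ s, walsh i s * walsh j s = if i = j then (Fintype.card (ι → ZMod 2) : ℝ) else 0 := by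
  simp_rw [← walsh_add_left]
  split_ifs with h
  · rw [h, ZModModule.add_self]
    simp only [walsh_zero_left, Finset.sum_const, Finset.card_univ, nsmul_eq_mul, mul_one]
  · exact sum_walsh_of_ne_zero (by rwa [← ZModModule.sub_eq_add, sub_ne_zero])

theorem exists_forall_abs_sum_walsh_mul_le {I Q : Type*} [Fintype I] [Nonempty I] [Fintype Q]
    (β : Q → I → ℝ) (hβ : ∀ q i, |β q i| = 1) :
    ∃ s : I → ι → ZMod 2, ∀ A ≠ 0, ∀ q, |∑ i, walsh A (s i) * β q i| ≤
      √(Fintype.card I) * (Real.log (2 * (2 ^ Fintype.card ι * Fintype.card Q)) + 1 / 2) := by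
  classical
  obtain ⟨s, hs⟩ := exists_forall_abs_sum_le (K := {A : ι → ZMod 2 // A ≠ 0} × Q)
    (fun k i s => walsh k.1.1 s * β k.2 i)
    (fun k i s => by rw [abs_mul, abs_walsh, hβ, one_mul])
    (fun k i => by rw [← Finset.sum_mul, sum_walsh_of_ne_zero k.1.2, zero_mul])
  refine ⟨s, fun A hA q => (hs (⟨A, hA⟩, q)).trans ?_⟩
  have hpos : 0 < Fintype.card ({A : ι → ZMod 2 // A ≠ 0} × Q) :=
    Fintype.card_pos_iff.2 ⟨⟨A, hA⟩, q⟩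
  have hcard : Fintype.card ({A : ι → ZMod 2 // A ≠ 0} × Q) ≤
      2 ^ Fintype.card ι * Fintype.card Q := by
    rw [Fintype.card_prod]
    gcongr
    exact (Fintype.card_subtype_le _).trans_eq (by simp)
  gcongr
  exact_mod_cast hcard

end Walsh

/-- The vertex set of the Boolean cube of dimension `n`. -/
abbrev Cube (n : ℕ) : Type := Fin n → ZMod 2

theorem sum_head_mul_tail {n : ℕ} (f : ZMod 2 → ℝ) (g : Cube n → ℝ) :
    ∑ i : Cube (n + 1), f (i 0) * g (Fin.tail i) = (∑ c, f c) * ∑ i, g i := by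
  rw [Finset.sum_mul_sum, ← Fintype.sum_prod_type']
  exact Fintype.sum_equiv (Fin.consEquiv _).symm _ _ fun i => rfl

theorem sum_mul_walsh_mul_mul_walsh {n : ℕ} (f g : Cube 2 → ℝ) (i j : Cube n) :
    ∑ q : Cube n × Cube 2, (f q.2 * walsh i q.1) * (g q.2 * walsh j q.1) =
      if i = j then Fintype.card (Cube n) * ∑ t, f t * g t else 0 := by
  simp_rw [Fintype.sum_prod_type, mul_mul_mul_comm (f _), ← Finset.sum_mul, ← Finset.mul_sum,
    sum_walsh_mul_walsh, mul_ite, mul_zero, mul_comm]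

/-- Four random signs for every Walsh function of the `n`-dimensional cube, encoded as a vertex of
the cube of dimension `2 + 2`. All four functions `walsh i` are multiplied by them: the first two
coordinates generate a twist of `walsh i` over `Cube 2`, and the last two separate the two systems
`blockB s false` and `blockB s true`. -/
abbrev SignChoice (n : ℕ) : Type := Cube n → Fin 2 ⊕ Fin 2 → ZMod 2

namespace SignChoice

variable {n : ℕ}

/-- The functions `b` determined by a choice of signs. -/
noncomputable def blockB (s : SignChoice n) (x : Bool) (i : Cube n) (q : Cube n × Cube 2) : ℝ :=
  walsh (Sum.elim q.2 ![1, cond x 1 0]) (s i) * walsh i q.1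

/-- The functions `a` determined by a choice of signs. The index `i` is the pair formed by the
Walsh function `Fin.tail i` and by the choice `i 0` of one of two orthogonal functions on
`Cube 2`; these two functions have mean zero, which makes `blockA s` orthogonal to `blockB s`. -/
noncomputable def blockA (s : SignChoice n) (i : Cube (n + 1)) (q : Cube n × Cube 2) : ℝ :=
  walsh (Sum.elim q.2 0) (s (Fin.tail i)) * walsh ![1, i 0] q.2 * walsh (Fin.tail i) q.1

theorem abs_blockB (s : SignChoice n) (x : Bool) (i : Cube n) (q : Cube n × Cube 2) :
    |s.blockB x i q| = 1 := by
  rw [blockB, abs_mul, abs_walsh, abs_walsh, one_mul]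

theorem abs_blockA (s : SignChoice n) (i : Cube (n + 1)) (q : Cube n × Cube 2) :
    |s.blockA i q| = 1 := by
  rw [blockA, abs_mul, abs_mul, abs_walsh, abs_walsh, abs_walsh, one_mul, one_mul]

theorem sum_blockB_mul_blockB (s : SignChoice n) (x : Bool) (i j : Cube n) :
    ∑ q, s.blockB x i q * s.blockB x j q =
      if i = j then (Fintype.card (Cube n × Cube 2) : ℝ) else 0 := by
  simp only [blockB]
  rw [sum_mul_walsh_mul_mul_walsh (fun t => walsh (Sum.elim t _) _)
    (fun t => walsh (Sum.elim t _) _)]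
  refine if_ctx_congr Iff.rfl (fun h => ?_) fun _ => rfl
  simp_rw [h, walsh_mul_self, Fintype.card_prod, Finset.sum_const, Finset.card_univ, nsmul_eq_mul,
    mul_one, Nat.cast_mul]

theorem sum_blockA_mul_blockA (s : SignChoice n) (i j : Cube (n + 1)) :
    ∑ q, s.blockA i q * s.blockA j q =
      if i = j then (Fintype.card (Cube n × Cube 2) : ℝ) else 0 := by
  simp only [blockA]
  rw [sum_mul_walsh_mul_mul_walsh (fun t => walsh (Sum.elim t _) _ * walsh _ t)
    (fun t => walsh (Sum.elim t _) _ * walsh _ t)]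
  by_cases htail : Fin.tail i = Fin.tail j
  · have hiff : ![1, i 0] = ![1, j 0] ↔ i = j :=
      ⟨fun h => by rw [← Fin.cons_self_tail i, ← Fin.cons_self_tail j, htail,
        show i 0 = j 0 from congrFun h 1], fun h => by rw [h]⟩
    have hsplit : ∀ t : Cube 2, walsh (Sum.elim t 0) (s (Fin.tail i)) * walsh ![1, i 0] t *
        (walsh (Sum.elim t 0) (s (Fin.tail j)) * walsh ![1, j 0] t) =
        walsh ![1, i 0] t * walsh ![1, j 0] t := by
      intro t
      rw [htail, mul_mul_mul_comm, walsh_mul_self, one_mul]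
    simp_rw [hsplit, if_pos htail, sum_walsh_mul_walsh, hiff, mul_ite, mul_zero,
      Fintype.card_prod, Nat.cast_mul]
  · rw [if_neg htail, if_neg (mt (congrArg Fin.tail) htail)]

theorem sum_blockB_mul_blockA (s : SignChoice n) (x : Bool) (i : Cube n) (j : Cube (n + 1)) :
    ∑ q, s.blockB x i q * s.blockA j q = 0 := by
  simp only [blockB, blockA]
  rw [sum_mul_walsh_mul_mul_walsh (fun t => walsh (Sum.elim t _) _)
    (fun t => walsh (Sum.elim t _) _ * walsh _ t)]
  split_ifs with h
  · have hsplit : ∀ t : Cube 2, walsh (Sum.elim t ![1, cond x 1 0]) (s i) *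
        (walsh (Sum.elim t 0) (s i) * walsh ![1, j 0] t) =
        walsh (Sum.elim 0 ![1, cond x 1 0]) (s i) * walsh ![1, j 0] t := by
      intro t
      rw [← mul_assoc, ← walsh_add_left, ← Sum.elim_add_add, ZModModule.add_self, add_zero]
    have hne : ![(1 : ZMod 2), j 0] ≠ 0 := fun h => one_ne_zero (congrFun h 0)
    simp_rw [← h, hsplit, ← Finset.mul_sum, sum_walsh_of_ne_zero hne, mul_zero]
  · rfl

/-- All the nontrivial products of the signs chosen by `s` are almost uncorrelated to `α`. -/
def Decorrelates {P : Type*} (s : SignChoice n) (α : Cube n → P → ℝ) (η : ℝ) : Prop :=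
  ∀ A ≠ 0, ∀ ω p, |(Fintype.card (Cube n) : ℝ)⁻¹ *
    ∑ i, walsh A (s i) * (walsh i ω * α i p)| ≤ η

theorem exists_decorrelates {P : Type*} [Fintype P] {α : Cube n → P → ℝ}
    (hα : ∀ i p, |α i p| = 1) (hP : Fintype.card P ≤ 2 ^ (n + 1)) :
    ∃ s : SignChoice n, s.Decorrelates α ((2 * n + 8) / √(2 ^ n)) ∧
      s.Decorrelates walsh ((2 * n + 8) / √(2 ^ n)) := by
  obtain ⟨s, hs⟩ := exists_forall_abs_sum_walsh_mul_le (ι := Fin 2 ⊕ Fin 2)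
    (fun (q : Cube n × (P ⊕ Cube n)) i => walsh i q.1 * Sum.elim (α i) (walsh i) q.2)
    (fun q i => by rcases q with ⟨ω, p | ω'⟩ <;> simp [abs_mul, abs_walsh, hα])
  have hcard : 2 * (2 ^ Fintype.card (Fin 2 ⊕ Fin 2) * Fintype.card (Cube n × (P ⊕ Cube n))) ≤
      2 ^ (7 + 2 * n) := by
    simp only [Fintype.card_sum, Fintype.card_fin, Fintype.card_prod, Fintype.card_fun, ZMod.card]
    calc 2 * (2 ^ (2 + 2) * (2 ^ n * (Fintype.card P + 2 ^ n)))
        ≤ 2 * (2 ^ (2 + 2) * (2 ^ n * (2 ^ (n + 1) + 2 ^ n))) := by gcongr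
      _ = 96 * 2 ^ (2 * n) := by ring
      _ ≤ 2 ^ (7 + 2 * n) := by
        rw [pow_add]
        gcongr
        norm_num
  have hlog : Real.log (2 * (2 ^ Fintype.card (Fin 2 ⊕ Fin 2) *
      Fintype.card (Cube n × (P ⊕ Cube n)))) ≤ 7 + 2 * n := by
    exact_mod_cast log_natCast_le_of_le_two_pow hcard
  have hsqrt : (Fintype.card (Cube n) : ℝ)⁻¹ * √(Fintype.card (Cube n)) = (√(2 ^ n))⁻¹ := by
    have hpos : (0 : ℝ) < 2 ^ n := by positivity
    rw [Fintype.card_fun, ZMod.card, Fintype.card_fin, Nat.cast_pow, Nat.cast_ofNat]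
    field_simp
    rw [Real.sq_sqrt hpos.le]
  have hle : ∀ A ≠ 0, ∀ q : Cube n × (P ⊕ Cube n), |(Fintype.card (Cube n) : ℝ)⁻¹ *
      ∑ i, walsh A (s i) * (walsh i q.1 * Sum.elim (α i) (walsh i) q.2)| ≤
      (2 * n + 8) / √(2 ^ n) := by
    intro A hA q
    rw [abs_mul, abs_of_nonneg (by positivity)]
    calc _ ≤ (Fintype.card (Cube n) : ℝ)⁻¹ * (√(Fintype.card (Cube n)) * (2 * n + 8)) := by
          gcongr
          exact (hs A hA q).trans (mul_le_mul_of_nonneg_left (by linarith) (Real.sqrt_nonneg _))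
      _ = (2 * n + 8) / √(2 ^ n) := by
          rw [← mul_assoc, hsqrt, inv_mul_eq_div]
  exact ⟨s, fun A hA ω p => hle A hA (ω, .inl p), fun A hA ω ω' => hle A hA (ω, .inr ω')⟩

theorem Decorrelates.abs_avg_blockB_mul_le {P : Type*} {s : SignChoice n} {α : Cube n → P → ℝ}
    {η : ℝ} (h : s.Decorrelates α η) (x : Bool) (q : Cube n × Cube 2) (p : P) :
    |(Fintype.card (Cube n) : ℝ)⁻¹ * ∑ i, s.blockB x i q * α i p| ≤ η := by
  simp_rw [blockB, mul_assoc]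
  exact h _ (fun h0 => one_ne_zero (congrFun h0 (.inr 0))) q.1 p

theorem blockB_mul_blockB (s : SignChoice n) (x y : Bool) (i : Cube n) (q q' : Cube n × Cube 2) :
    s.blockB x i q * s.blockB y i q' =
      walsh (Sum.elim (q.2 + q'.2) (![1, cond x 1 0] + ![1, cond y 1 0])) (s i) *
        (walsh i q.1 * walsh i q'.1) := by
  rw [blockB, blockB, mul_mul_mul_comm, ← walsh_add_left, ← Sum.elim_add_add]

theorem Decorrelates.abs_avg_blockB_mul_blockB_le {s : SignChoice n} {η : ℝ}
    (h : s.Decorrelates walsh η) {x y : Bool} (hxy : x ≠ y) (q q' : Cube n × Cube 2) :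
    |(Fintype.card (Cube n) : ℝ)⁻¹ * ∑ i, s.blockB x i q * s.blockB y i q'| ≤ η := by
  simp_rw [blockB_mul_blockB]
  refine h _ (fun h0 => ?_) q.1 q'.1
  have hsum := congrFun h0 (.inr 1)
  revert hsum
  cases x <;> cases y <;> simp_all

theorem Decorrelates.abs_avg_blockB_sub_avg_blockA_le {s : SignChoice n} {η : ℝ}
    (h : s.Decorrelates walsh η) (x : Bool) (q q' : Cube n × Cube 2) :
    |(Fintype.card (Cube n) : ℝ)⁻¹ * ∑ i, s.blockB x i q * s.blockB x i q' -
      (Fintype.card (Cube (n + 1)) : ℝ)⁻¹ * ∑ i, s.blockA i q * s.blockA i q'| ≤ 2 * η := by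
  set u : Cube 2 := q.2 + q'.2
  set Q : ℝ := ∑ i, walsh (Sum.elim u 0) (s i) * (walsh i q.1 * walsh i q'.1)
  set κ : ℝ := ∑ c : ZMod 2, walsh ![1, c] u
  have hB : ∑ i, s.blockB x i q * s.blockB x i q' = Q := by
    refine Finset.sum_congr rfl fun i _ => ?_
    rw [blockB_mul_blockB, ZModModule.add_self]
  have hA : ∑ i, s.blockA i q * s.blockA i q' = κ * Q := by
    rw [← sum_head_mul_tail]
    refine Finset.sum_congr rfl fun i _ => ?_
    rw [walsh_comm _ u, walsh_add_left, walsh_comm q.2, walsh_comm q'.2,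
      show Sum.elim u (0 : Cube 2) = Sum.elim q.2 0 + Sum.elim q'.2 0 by
        rw [← Sum.elim_add_add, add_zero], walsh_add_left, blockA, blockA]
    ring
  have hcard : (Fintype.card (Cube (n + 1)) : ℝ) = 2 * Fintype.card (Cube n) := by
    simp [pow_succ']
  have hfactor : (Fintype.card (Cube n) : ℝ)⁻¹ * Q - (Fintype.card (Cube (n + 1)) : ℝ)⁻¹ * (κ * Q) =
      (1 - κ / 2) * ((Fintype.card (Cube n) : ℝ)⁻¹ * Q) := by
    rw [hcard, mul_inv]
    ring
  rw [hA, hB, hfactor, abs_mul]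
  by_cases hu : u = 0
  · have hη : 0 ≤ η := (abs_nonneg _).trans (h.abs_avg_blockB_mul_le x q q'.1)
    have hκ : κ = 2 := by simp [κ, hu, walsh_comm _ 0, walsh_zero_left]
    rw [hκ, div_self two_ne_zero, sub_self, abs_zero, zero_mul]
    positivity
  · have hQ : |(Fintype.card (Cube n) : ℝ)⁻¹ * Q| ≤ η :=
      h _ (fun h0 => hu (funext fun c => congrFun h0 (.inl c))) q.1 q'.1
    have hκ : |κ| ≤ 2 := by
      refine (Finset.abs_sum_le_sum_abs _ _).trans_eq ?_
      simp [abs_walsh]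
    have hfactor2 : |1 - κ / 2| ≤ 2 := by
      rw [abs_le] at hκ ⊢
      constructor <;> linarith [hκ.1, hκ.2]
    gcongr

end SignChoice

theorem SignChoice.exists_seq_decorrelates : ∃ s : ∀ n, SignChoice n, ∀ n,
    (s (n + 1)).Decorrelates (s n).blockA ((2 * (n + 1 : ℕ) + 8) / √(2 ^ (n + 1))) ∧
      (s (n + 1)).Decorrelates walsh ((2 * (n + 1 : ℕ) + 8) / √(2 ^ (n + 1))) := by
  have hstep : ∀ n (s : SignChoice n), ∃ s' : SignChoice (n + 1),
      s'.Decorrelates s.blockA ((2 * (n + 1 : ℕ) + 8) / √(2 ^ (n + 1))) ∧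
        s'.Decorrelates walsh ((2 * (n + 1 : ℕ) + 8) / √(2 ^ (n + 1))) := fun n s =>
    exists_decorrelates s.abs_blockA (by simp [pow_succ, mul_assoc])
  choose next hnext using hstep
  exact ⟨fun n => Nat.rec (motive := SignChoice) 0 next n, fun n => hnext n _⟩

/-- Systems of unimodular functions, orthogonal for the bilinear pairing: `a n` and `b n x` are
indexed by `I n`, live on `Ω n` and on `Ω (n + 1)`, and have averaged correlations of size at most
`η n`. -/
structure SignSystem (𝕜 : Type*) [RCLike 𝕜] (I Ω : ℕ → Type*) [∀ n, Fintype (I n)]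
    [∀ n, DecidableEq (I n)] [∀ n, Fintype (Ω n)] where
  a : ∀ n, I n → Ω n → 𝕜
  b : ∀ n, Bool → I n → Ω (n + 1) → 𝕜
  η : ℕ → ℝ
  norm_a : ∀ n i ω, ‖a n i ω‖ = 1
  norm_b : ∀ n x i ω, ‖b n x i ω‖ = 1
  sum_a_a : ∀ n i j, ∑ ω, a n i ω * a n j ω = if i = j then (Fintype.card (Ω n) : 𝕜) else 0
  sum_b_b : ∀ n x i j, ∑ ω, b n x i ω * b n x j ω =
    if i = j then (Fintype.card (Ω (n + 1)) : 𝕜) else 0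
  sum_b_a : ∀ n x i j, ∑ ω, b n x i ω * a (n + 1) j ω = 0
  avg_b_a : ∀ n x ω ω', ‖(Fintype.card (I n) : 𝕜)⁻¹ * ∑ i, b n x i ω * a n i ω'‖ ≤ η n
  avg_b_b : ∀ n x y ω ω', x ≠ y →
    ‖(Fintype.card (I n) : 𝕜)⁻¹ * ∑ i, b n x i ω * b n y i ω'‖ ≤ η n
  avg_sub : ∀ n x ω ω', ‖(Fintype.card (I n) : 𝕜)⁻¹ * ∑ i, b n x i ω * b n x i ω' -
    (Fintype.card (I (n + 1)) : 𝕜)⁻¹ * ∑ i, a (n + 1) i ω * a (n + 1) i ω'‖ ≤ η n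

/-- The error attached to the passage from level `n` to level `n + 1`, when the functions on `Ω m`
are replaced by block vectors of norm at most `|Ω m| ^ θ`. -/
noncomputable def SignSystem.error {𝕜 : Type*} [RCLike 𝕜] {I Ω : ℕ → Type*} [∀ n, Fintype (I n)]
    [∀ n, DecidableEq (I n)] [∀ n, Fintype (Ω n)] (S : SignSystem 𝕜 I Ω) (θ : ℝ) (n : ℕ) : ℝ :=
  S.η n * (Fintype.card (Ω n) : ℝ) ^ θ + S.η n * (Fintype.card (Ω (n + 1)) : ℝ) ^ θ +
    S.η (n + 1) * (Fintype.card (Ω (n + 2)) : ℝ) ^ θ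

/-- The sign system whose functions are determined by a sequence of decorrelating sign choices. -/
noncomputable def SignSystem.ofSignChoice (𝕜 : Type*) [RCLike 𝕜] (s : ∀ n, SignChoice n)
    (ζ : ℕ → ℝ) (hA : ∀ n, (s (n + 1)).Decorrelates (s n).blockA (ζ n))
    (hW : ∀ n, (s (n + 1)).Decorrelates walsh (ζ n)) :
    SignSystem 𝕜 (fun n => Cube (n + 1)) (fun n => Cube n × Cube 2) where
  a n i q := (s n).blockA i q
  b n x i q := (s (n + 1)).blockB x i q
  η n := 2 * ζ n
  norm_a n i q := by rw [RCLike.norm_ofReal, (s n).abs_blockA]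
  norm_b n x i q := by rw [RCLike.norm_ofReal, (s (n + 1)).abs_blockB]
  sum_a_a n i j := by
    have h := congrArg ((↑) : ℝ → 𝕜) ((s n).sum_blockA_mul_blockA i j)
    rw [apply_ite ((↑) : ℝ → 𝕜)] at h
    push_cast at h
    exact_mod_cast h
  sum_b_b n x i j := by
    have h := congrArg ((↑) : ℝ → 𝕜) ((s (n + 1)).sum_blockB_mul_blockB x i j)
    rw [apply_ite ((↑) : ℝ → 𝕜)] at h
    push_cast at h
    exact_mod_cast h
  sum_b_a n x i j := by
    simpa using congrArg ((↑) : ℝ → 𝕜) ((s (n + 1)).sum_blockB_mul_blockA x i j)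
  avg_b_a n x q q' := by
    have h := (hA n).abs_avg_blockB_mul_le x q q'
    rw [← RCLike.norm_ofReal (K := 𝕜)] at h
    push_cast at h
    exact h.trans (le_mul_of_one_le_left ((norm_nonneg _).trans h) one_le_two)
  avg_b_b n x y q q' hxy := by
    have h := (hW n).abs_avg_blockB_mul_blockB_le hxy q q'
    rw [← RCLike.norm_ofReal (K := 𝕜)] at h
    push_cast at h
    exact h.trans (le_mul_of_one_le_left ((norm_nonneg _).trans h) one_le_two)
  avg_sub n x q q' := by
    have h := (hW n).abs_avg_blockB_sub_avg_blockA_le x q q'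
    rw [← RCLike.norm_ofReal (K := 𝕜)] at h
    push_cast at h
    exact h

theorem summable_linear_div_sqrt_two_pow_mul_rpow {θ : ℝ} (hθ : θ < 1 / 2) (a b : ℝ) :
    Summable fun n : ℕ => (a * n + b) / √(2 ^ n) * (2 ^ n) ^ θ := by
  set r : ℝ := 2 ^ (θ - 1 / 2)
  have hr : 0 ≤ r := by positivity
  have hr1 : r < 1 := Real.rpow_lt_one_of_one_lt_of_neg one_lt_two (by linarith)
  have hlinear : Summable fun n : ℕ => (n : ℝ) ^ 1 * r ^ n :=
    summable_pow_mul_geometric_of_norm_lt_one 1 (by rwa [Real.norm_of_nonneg hr])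
  refine ((hlinear.mul_left a).add ((summable_geometric_of_lt_one hr hr1).mul_left b)).congr
    fun n => ?_
  rw [Real.rpow_pow_comm zero_le_two, Real.rpow_sub (by positivity), Real.sqrt_eq_rpow]
  ring

theorem SignSystem.exists_summable_error (𝕜 : Type*) [RCLike 𝕜] {θ : ℝ} (hθ : θ < 1 / 2) :
    ∃ S : SignSystem 𝕜 (fun n => Cube (n + 1)) (fun n => Cube n × Cube 2),
      Summable (S.error θ) := by
  obtain ⟨s, hs⟩ := SignChoice.exists_seq_decorrelates
  set S := SignSystem.ofSignChoice 𝕜 s _ (fun n => (hs n).1) (fun n => (hs n).2)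
  have hcard : ∀ n k : ℕ,
      (Fintype.card (Cube (n + k) × Cube 2) : ℝ) = 2 ^ (n + 1) * 2 ^ (k + 1) := by
    intro n k
    simp only [Fintype.card_prod, Fintype.card_fun, ZMod.card, Fintype.card_fin]
    push_cast
    ring
  have hsum : ∀ k : ℕ,
      Summable fun n => S.η n * (Fintype.card (Cube (n + k) × Cube 2) : ℝ) ^ θ := by
    intro k
    refine (((summable_nat_add_iff 1).2 (summable_linear_div_sqrt_two_pow_mul_rpow hθ 2 8)).mul_left
      (2 * (2 ^ (k + 1)) ^ θ)).congr fun n => ?_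
    rw [hcard, Real.mul_rpow (by positivity) (by positivity)]
    simp only [S, SignSystem.ofSignChoice]
    ring
  exact ⟨S, ((hsum 0).add (hsum 1)).add ((summable_nat_add_iff 1).2 (hsum 1))⟩

theorem exists_finset_norm_le_two_mul {𝕜 X : Type*} [RCLike 𝕜] [NormedAddCommGroup X]
    [NormedSpace 𝕜 X] (E : Submodule 𝕜 X) [FiniteDimensional 𝕜 E] :
    ∃ Ψ : Finset (X →L[𝕜] 𝕜), (∀ ψ ∈ Ψ, ‖ψ‖ ≤ 1) ∧ ∀ v ∈ E, v ≠ 0 → ∃ ψ ∈ Ψ, ‖v‖ ≤ 2 * ‖ψ v‖ := by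
  classical
  have : ProperSpace E := FiniteDimensional.proper 𝕜 E
  choose ψ hψ hψv using fun v : E => exists_dual_vector'' 𝕜 (v : X)
  obtain ⟨t, ht⟩ := (isCompact_sphere (0 : E) 1).elim_finite_subcover
    (fun v : E => {u : E | 1 / 2 < ‖ψ v u‖})
    (fun v => isOpen_lt continuous_const (by fun_prop)) fun v hv => by
      have hv1 : ‖(v : X)‖ = 1 := by simpa using hv
      refine Set.mem_iUnion.2 ⟨v, ?_⟩
      norm_num [hψv, hv1]
  refine ⟨t.image ψ, Finset.forall_mem_image.2 fun v _ => hψ v, fun v hv h0 => ?_⟩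
  have hv0 : 0 < ‖v‖ := norm_pos_iff.2 h0
  have hunit : ((‖v‖ : 𝕜)⁻¹) • (⟨v, hv⟩ : E) ∈ Metric.sphere (0 : E) 1 := by
    simp [norm_smul, hv0.ne']
  obtain ⟨u, hut, hu⟩ := Set.mem_iUnion₂.1 (ht hunit)
  refine ⟨ψ u, Finset.mem_image_of_mem _ hut, ?_⟩
  simp only [Set.mem_ofPred_eq, Submodule.coe_smul, map_smul, norm_smul, norm_inv,
    RCLike.norm_ofReal, abs_norm] at hu
  rw [inv_mul_eq_div, lt_div_iff₀ hv0] at hu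
  linarith

theorem exists_cofg_norm_le_three_mul {𝕜 X : Type*} [RCLike 𝕜] [NormedAddCommGroup X]
    [NormedSpace 𝕜 X] (E : Submodule 𝕜 X) [FiniteDimensional 𝕜 E] :
    ∃ N : Submodule 𝕜 X, N.CoFG ∧ ∀ v ∈ N, ∀ u ∈ E, ‖v‖ ≤ 3 * ‖v - u‖ := by
  obtain ⟨Ψ, hΨ, hE⟩ := exists_finset_norm_le_two_mul E
  refine ⟨_, Submodule.CoFG.ker (LinearMap.pi fun ψ : Ψ => (ψ : X →L[𝕜] 𝕜).toLinearMap),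
    fun v hv u hu => ?_⟩
  rcases eq_or_ne u 0 with rfl | h0
  · rw [sub_zero]
    linarith [norm_nonneg v]
  obtain ⟨ψ, hψ, hψu⟩ := hE u hu h0
  have hv0 : ψ v = 0 := congrFun (LinearMap.mem_ker.1 hv) ⟨ψ, hψ⟩
  have hψv : ‖ψ u‖ ≤ ‖v - u‖ := by
    simpa [hv0] using ψ.le_of_opNorm_le (hΨ ψ hψ) (v - u)
  calc ‖v‖ ≤ ‖v - u‖ + ‖u‖ := norm_le_norm_sub_add v u
    _ ≤ 3 * ‖v - u‖ := by linarith

theorem exists_functional_of_le_norm_sub {𝕜 X : Type*} [RCLike 𝕜] [NormedAddCommGroup X]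
    [NormedSpace 𝕜 X] (W : Submodule 𝕜 X) (v : X) {r : ℝ} (hr : 0 < r)
    (h : ∀ w ∈ W, r ≤ ‖v - w‖) :
    ∃ f : X →L[𝕜] 𝕜, f v = 1 ∧ (∀ w ∈ W, f w = 0) ∧ ∀ u, ‖f u‖ ≤ r⁻¹ * ‖u‖ := by
  have hdist : r ≤ ‖W.mkQL v‖ := by
    rw [show ‖W.mkQL v‖ = Metric.infDist v W from
      QuotientAddGroup.norm_mk (S := W.toAddSubgroup) v]
    refine (Metric.le_infDist ⟨0, W.zero_mem⟩).2 fun w hw => ?_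
    rw [dist_eq_norm]
    exact h w hw
  have hpos : 0 < ‖W.mkQL v‖ := hr.trans_le hdist
  have hne : (‖W.mkQL v‖ : 𝕜) ≠ 0 := by exact_mod_cast hpos.ne'
  obtain ⟨g, hg, hgv⟩ := exists_dual_vector 𝕜 (W.mkQL v) hpos.ne'
  refine ⟨((‖W.mkQL v‖ : 𝕜)⁻¹) • (g.comp W.mkQL), ?_, fun w hw => ?_, fun u => ?_⟩
  · simp only [smul_apply, ContinuousLinearMap.comp_apply, hgv, smul_eq_mul]
    exact inv_mul_cancel₀ hne
  · simp [show W.mkQL w = 0 by simpa using hw]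
  · have hgu : ‖g (W.mkQL u)‖ ≤ ‖u‖ := by
      refine (g.le_opNorm _).trans ?_
      rw [hg, one_mul]
      exact QuotientAddGroup.norm_mk_le_norm (S := W.toAddSubgroup)
    simp only [smul_apply, ContinuousLinearMap.comp_apply, norm_smul, norm_inv,
      RCLike.norm_ofReal, abs_norm]
    gcongr

section Disjoint

variable {𝕜 : Type*} [RCLike 𝕜] {p : ℝ≥0∞} {Ω : Type*} [Fintype Ω]
  {f : Ω → lp (fun _ : ℕ => 𝕜) p}

theorem lp_sum_smul_apply_of_mem_support
    (hf : Pairwise (Function.onFun Disjoint fun ω => Function.support (f ω))) (c : Ω → 𝕜)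
    {m : ℕ} {ω : Ω} (h : m ∈ Function.support (f ω)) : (∑ ω, c ω • f ω) m = c ω * f ω m := by
  rw [lp.coeFn_sum, Finset.sum_apply, Finset.sum_eq_single ω]
  · simp
  · intro ω' _ hω'
    have h0 : f ω' m = 0 := Function.notMem_support.1 (Set.disjoint_right.1 (hf hω') h)
    simp [h0]
  · simp

theorem lp_sum_smul_apply_of_notMem_support (c : Ω → 𝕜) {m : ℕ}
    (h : ∀ ω, m ∉ Function.support (f ω)) : (∑ ω, c ω • f ω) m = 0 := by
  rw [lp.coeFn_sum, Finset.sum_apply]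
  exact Finset.sum_eq_zero fun ω _ => by simp [Function.notMem_support.1 (h ω)]

theorem norm_le_norm_lp_sum_smul [Fact (1 ≤ p)]
    (hf : Pairwise (Function.onFun Disjoint fun ω => Function.support (f ω)))
    (h1 : ∀ ω, ‖f ω‖ = 1) (c : Ω → 𝕜) : ‖c‖ ≤ ‖∑ ω, c ω • f ω‖ := by
  refine (pi_norm_le_iff_of_nonneg (norm_nonneg _)).2 fun ω => ?_
  calc ‖c ω‖ = ‖c ω • f ω‖ := by rw [norm_smul, h1, mul_one]
    _ ≤ ‖∑ ω, c ω • f ω‖ := by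
      refine lp.norm_mono (zero_lt_one.trans_le (Fact.out : 1 ≤ p)).ne' fun m => ?_
      by_cases h : m ∈ Function.support (f ω)
      · rw [lp_sum_smul_apply_of_mem_support hf c h]
        simp
      · simp [Function.notMem_support.1 h]

theorem norm_rpow_lp_sum_smul_apply_le
    (hf : Pairwise (Function.onFun Disjoint fun ω => Function.support (f ω)))
    {r : ℝ} (hr : 0 < r) (c : Ω → 𝕜) (m : ℕ) :
    ‖(∑ ω, c ω • f ω) m‖ ^ r ≤ ‖c‖ ^ r * ∑ ω, ‖f ω m‖ ^ r := by
  by_cases h : ∃ ω, m ∈ Function.support (f ω)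
  · obtain ⟨ω, hω⟩ := h
    rw [lp_sum_smul_apply_of_mem_support hf c hω, norm_mul,
      Real.mul_rpow (norm_nonneg _) (norm_nonneg _)]
    gcongr
    · exact norm_le_pi_norm c ω
    · exact Finset.single_le_sum (f := fun ω => ‖f ω m‖ ^ r) (fun ω _ => by positivity)
        (Finset.mem_univ ω)
  · rw [not_exists] at h
    rw [lp_sum_smul_apply_of_notMem_support c h, norm_zero, Real.zero_rpow hr.ne']
    positivity

theorem norm_lp_sum_smul_le [Fact (1 ≤ p)]
    (hf : Pairwise (Function.onFun Disjoint fun ω => Function.support (f ω)))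
    (h1 : ∀ ω, ‖f ω‖ = 1) (c : Ω → 𝕜) :
    ‖∑ ω, c ω • f ω‖ ≤ (Fintype.card Ω : ℝ) ^ p.toReal⁻¹ * ‖c‖ := by
  have hp : p ≠ 0 := (zero_lt_one.trans_le (Fact.out : 1 ≤ p)).ne'
  rcases eq_or_ne p ∞ with rfl | hptop
  · rw [ENNReal.toReal_top, inv_zero, Real.rpow_zero, one_mul]
    refine lp.norm_le_of_forall_le (norm_nonneg c) fun m => ?_
    by_cases h : ∃ ω, m ∈ Function.support (f ω)
    · obtain ⟨ω, hω⟩ := h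
      rw [lp_sum_smul_apply_of_mem_support hf c hω, norm_mul, ← mul_one ‖c‖]
      exact mul_le_mul (norm_le_pi_norm c ω)
        ((lp.norm_apply_le_norm hp (f ω) m).trans_eq (h1 ω)) (norm_nonneg _) (norm_nonneg c)
    · rw [not_exists] at h
      rw [lp_sum_smul_apply_of_notMem_support c h, norm_zero]
      exact norm_nonneg c
  · have hp0 : 0 < p.toReal := ENNReal.toReal_pos hp hptop
    refine lp.norm_le_of_forall_sum_le hp0 (by positivity) fun s => ?_
    calc ∑ m ∈ s, ‖(∑ ω, c ω • f ω) m‖ ^ p.toReal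
        ≤ ∑ m ∈ s, ‖c‖ ^ p.toReal * ∑ ω, ‖f ω m‖ ^ p.toReal := by
          gcongr with m
          exact norm_rpow_lp_sum_smul_apply_le hf hp0 c m
      _ = ‖c‖ ^ p.toReal * ∑ ω, ∑ m ∈ s, ‖f ω m‖ ^ p.toReal := by
          rw [← Finset.mul_sum, Finset.sum_comm]
      _ ≤ ‖c‖ ^ p.toReal * ∑ _ω : Ω, 1 := by
          gcongr with ω
          simpa [h1] using lp.sum_rpow_le_norm_rpow hp0 (f ω) s
      _ = ((Fintype.card Ω : ℝ) ^ p.toReal⁻¹ * ‖c‖) ^ p.toReal := by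
          rw [Real.mul_rpow (by positivity) (norm_nonneg c), ← Real.rpow_mul (by positivity),
            inv_mul_cancel₀ hp0.ne', Real.rpow_one]
          simp [mul_comm]

end Disjoint

theorem exists_mem_span_norm_eq_one_of_card_lt {𝕜 E V J : Type*} [RCLike 𝕜] [NormedAddCommGroup E]
    [NormedSpace 𝕜 E] [AddCommGroup V] [Module 𝕜 V] [FiniteDimensional 𝕜 V] [Fintype J]
    {g : J → E} (hg : LinearIndependent 𝕜 g) (hJ : Module.finrank 𝕜 V < Fintype.card J)
    (L : E →ₗ[𝕜] V) : ∃ v ∈ Submodule.span 𝕜 (Set.range g), L v = 0 ∧ ‖v‖ = 1 := by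
  have hker : LinearMap.ker (L.domRestrict (Submodule.span 𝕜 (Set.range g))) ≠ ⊥ := by
    have := FiniteDimensional.span_of_finite 𝕜 (Set.finite_range g)
    exact LinearMap.ker_ne_bot_of_finrank_lt (by rwa [finrank_span_eq_card hg])
  obtain ⟨v, hv, hv0⟩ := Submodule.exists_mem_ne_zero_of_ne_bot hker
  have hLv : L v = 0 := hv
  refine ⟨(‖(v : E)‖⁻¹ : 𝕜) • (v : E), Submodule.smul_mem _ _ v.2, by simp [hLv],
    norm_smul_inv_norm (by simpa using hv0)⟩

theorem linearIndependent_lp_single (𝕜 : Type*) [RCLike 𝕜] (p : ℝ≥0∞) :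
    LinearIndependent 𝕜 fun m => (lp.single p m 1 : lp (fun _ : ℕ => 𝕜) p) := by
  exact .of_comp (LinearMap.pi (lp.evalₗ (𝕜 := 𝕜) (fun _ : ℕ => 𝕜) p))
    (Pi.linearIndependent_single_one ℕ 𝕜)

theorem exists_submodule_forall_exists_disjoint_support (𝕜 V : Type*) [RCLike 𝕜] [AddCommGroup V]
    [Module 𝕜 V] [FiniteDimensional 𝕜 V] (p : ℝ≥0∞) [Fact (1 ≤ p)] (Ω : Type*) [Finite Ω] :
    ∃ F : Submodule 𝕜 (lp (fun _ : ℕ => 𝕜) p), FiniteDimensional 𝕜 F ∧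
      ∀ L : F →ₗ[𝕜] V, ∃ f : Ω → F, (∀ ω, L (f ω) = 0) ∧ (∀ ω, ‖f ω‖ = 1) ∧
        Pairwise (Function.onFun Disjoint fun ω => Function.support (f ω : ℕ → 𝕜)) := by
  obtain ⟨k, hk⟩ := exists_injective_nat (Ω × Fin (Module.finrank 𝕜 V + 1))
  let g q : lp (fun _ : ℕ => 𝕜) p := lp.single p (k q) 1
  let F := Submodule.span 𝕜 (Set.range g)
  have hg q : g q ∈ F := Submodule.subset_span ⟨q, rfl⟩
  refine ⟨F, FiniteDimensional.span_of_finite 𝕜 (Set.finite_range g), fun L => ?_⟩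
  have hindep ω : LinearIndependent 𝕜 fun j => (⟨g (ω, j), hg (ω, j)⟩ : F) :=
    .of_comp F.subtype ((linearIndependent_lp_single 𝕜 p).comp (fun j => k (ω, j))
      (hk.comp (Prod.mk_right_injective ω)))
  choose f hf hLf hf1 using fun ω =>
    exists_mem_span_norm_eq_one_of_card_lt (hindep ω) (by simp) L
  have hsupp ω m (h : m ∉ Set.range fun j => k (ω, j)) : (f ω : ℕ → 𝕜) m = 0 := by
    have hle : Submodule.span 𝕜 (Set.range fun j => (⟨g (ω, j), hg (ω, j)⟩ : F)) ≤
        LinearMap.ker (lp.evalₗ (fun _ : ℕ => 𝕜) p m ∘ₗ F.subtype) :=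
      Submodule.span_le.2 <| Set.range_subset_iff.2 fun j =>
        lp.single_apply_ne p _ _ fun hm => h ⟨j, hm.symm⟩
    exact hle (hf ω)
  refine ⟨f, hLf, hf1, fun ω ω' hne => Set.disjoint_left.2 fun m hm hm' => hne ?_⟩
  obtain ⟨j, rfl⟩ : m ∈ Set.range fun j => k (ω, j) := not_imp_comm.1 (hsupp ω m) hm
  obtain ⟨j', hj'⟩ := not_imp_comm.1 (hsupp ω' _) hm'
  exact congrArg Prod.fst (hk hj').symm

theorem CrudelyFinitelyRepresentableWith.exists_linearMap {𝕜 X Y : Type*} [RCLike 𝕜]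
    [NormedAddCommGroup X] [NormedSpace 𝕜 X] [NormedAddCommGroup Y] [NormedSpace 𝕜 Y] {K : ℝ}
    (h : CrudelyFinitelyRepresentableWith 𝕜 X Y K) (F : Submodule 𝕜 X) [FiniteDimensional 𝕜 F] :
    ∃ R : F →ₗ[𝕜] Y, ∀ v, ‖R v‖ ≤ ‖v‖ ∧ ‖v‖ ≤ K * ‖R v‖ := by
  obtain ⟨G, T, hT⟩ := h F inferInstance
  set N : ℝ := ‖(T : F →L[𝕜] G)‖
  refine ⟨((N : 𝕜)⁻¹) • (G.subtype ∘ₗ T.toLinearEquiv.toLinearMap), fun v => ?_⟩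
  rcases eq_or_ne v 0 with rfl | hv
  · simp
  have hTv : ‖T v‖ ≤ N * ‖v‖ := (T : F →L[𝕜] G).le_opNorm v
  have hN : 0 < N := by
    refine (norm_nonneg (T : F →L[𝕜] G)).lt_of_ne' fun hN => hv ?_
    simpa [N, hN] using hTv
  have hR : ‖(((N : 𝕜)⁻¹) • (G.subtype ∘ₗ T.toLinearEquiv.toLinearMap)) v‖ = N⁻¹ * ‖T v‖ := by
    simp [norm_smul, abs_of_pos hN]
  rw [hR]
  constructor
  · rwa [inv_mul_le_iff₀ hN]
  · calc ‖v‖ = ‖(T.symm : G →L[𝕜] F) (T v)‖ := by simp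
      _ ≤ ‖(T.symm : G →L[𝕜] F)‖ * ‖T v‖ := (T.symm : G →L[𝕜] F).le_opNorm _
      _ = N * ‖(T.symm : G →L[𝕜] F)‖ * (N⁻¹ * ‖T v‖) := by field_simp
      _ ≤ K * (N⁻¹ * ‖T v‖) := by gcongr

theorem CrudelyFinitelyRepresentableWith.exists_linearMap_of_cofg {𝕜 X : Type*} [RCLike 𝕜]
    [NormedAddCommGroup X] [NormedSpace 𝕜 X] {p : ℝ≥0∞} [Fact (1 ≤ p)] {K : ℝ}
    (h : CrudelyFinitelyRepresentableWith 𝕜 (lp (fun _ : ℕ => 𝕜) p) X K) {N : Submodule 𝕜 X}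
    (hN : N.CoFG) (Ω : Type*) [Fintype Ω] :
    ∃ S : (Ω → 𝕜) →ₗ[𝕜] X, ∀ c, S c ∈ N ∧ ‖c‖ ≤ K * ‖S c‖ ∧
      ‖S c‖ ≤ (Fintype.card Ω : ℝ) ^ p.toReal⁻¹ * ‖c‖ := by
  obtain ⟨F, _, hF⟩ := exists_submodule_forall_exists_disjoint_support 𝕜 (X ⧸ N) p Ω
  obtain ⟨R, hR⟩ := h.exists_linearMap F
  obtain ⟨f, hfN, hf1, hfd⟩ := hF (N.mkQ ∘ₗ R)
  have hfN' ω : R (f ω) ∈ N := by simpa using hfN ω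
  refine ⟨R ∘ₗ Fintype.linearCombination 𝕜 f, fun c => ?_⟩
  have hnorm : ‖Fintype.linearCombination 𝕜 f c‖ =
      ‖∑ ω, c ω • (f ω : lp (fun _ : ℕ => 𝕜) p)‖ := by
    rw [Submodule.coe_norm]
    simp [Fintype.linearCombination_apply]
  refine ⟨?_, ?_, (hR _).1.trans ?_⟩
  · simpa [Fintype.linearCombination_apply] using
      Submodule.sum_mem N fun ω _ => N.smul_mem (c ω) (hfN' ω)
  · refine le_trans ?_ (hR _).2
    rw [hnorm]
    exact norm_le_norm_lp_sum_smul hfd hf1 c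
  · rw [hnorm]
    exact norm_lp_sum_smul_le hfd hf1 c

/-- A copy of `Ω → 𝕜` (with its sup norm) in `X`, complemented through coordinate functionals of
norm at most `C`, on which the norm is at most `|Ω| ^ θ` times the sup norm. -/
structure FlatBlock (𝕜 X Ω : Type*) [RCLike 𝕜] [NormedAddCommGroup X] [NormedSpace 𝕜 X]
    [Fintype Ω] (θ C : ℝ) where
  incl : (Ω → 𝕜) →ₗ[𝕜] X
  coord : X →L[𝕜] Ω → 𝕜
  coord_incl : ∀ c, coord (incl c) = c
  norm_coord_apply_le : ∀ v ω, ‖coord v ω‖ ≤ C * ‖v‖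
  norm_incl_le : ∀ c, ‖incl c‖ ≤ (Fintype.card Ω : ℝ) ^ θ * ‖c‖

theorem exists_coord_of_le_norm {𝕜 X Ω : Type*} [RCLike 𝕜] [NormedAddCommGroup X]
    [NormedSpace 𝕜 X] [Fintype Ω] {C : ℝ} (S : (Ω → 𝕜) →ₗ[𝕜] X) (E : Submodule 𝕜 X)
    (h : ∀ c, ∀ u ∈ E, ‖c‖ ≤ C * ‖S c - u‖) :
    ∃ P : X →L[𝕜] Ω → 𝕜, (∀ c, P (S c) = c) ∧ (∀ u ∈ E, P u = 0) ∧
      ∀ v ω, ‖P v ω‖ ≤ C * ‖v‖ := by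
  classical
  have hfun ω : ∃ f : X →L[𝕜] 𝕜, f (S (Pi.single ω 1)) = 1 ∧
      (∀ w ∈ E ⊔ (LinearMap.ker (LinearMap.proj ω)).map S, f w = 0) ∧
      ∀ v, ‖f v‖ ≤ C⁻¹⁻¹ * ‖v‖ := by
    have hC : 0 < C := by
      have h0 := h (Pi.single ω 1) 0 E.zero_mem
      rw [Pi.norm_single, norm_one] at h0
      exact pos_of_mul_pos_left (zero_lt_one.trans_le h0) (norm_nonneg _)
    refine exists_functional_of_le_norm_sub _ _ (inv_pos.2 hC) fun w hw => ?_
    obtain ⟨u, hu, _, ⟨c, hc, rfl⟩, rfl⟩ := Submodule.mem_sup.1 hw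
    have hc0 : c ω = 0 := hc
    rw [inv_le_iff_one_le_mul₀ hC, mul_comm]
    calc (1 : ℝ) = ‖(Pi.single ω 1 - c : Ω → 𝕜) ω‖ := by simp [hc0]
      _ ≤ ‖Pi.single ω 1 - c‖ := norm_le_pi_norm _ ω
      _ ≤ C * ‖S (Pi.single ω 1 - c) - u‖ := h _ u hu
      _ = C * ‖S (Pi.single ω 1) - (u + S c)‖ := by rw [map_sub, sub_sub, add_comm u]
  choose f hf1 hf0 hf using hfun
  refine ⟨ContinuousLinearMap.pi f, fun c => funext fun ω => ?_,
    fun u hu => funext fun ω => hf0 ω u (Submodule.mem_sup_left hu),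
    fun v ω => by simpa using hf ω v⟩
  have hker : f ω (S (c - c ω • Pi.single ω 1)) = 0 :=
    hf0 ω _ (Submodule.mem_sup_right (Submodule.mem_map_of_mem (by simp)))
  simpa [hf1, sub_eq_zero] using hker

theorem CrudelyFinitelyRepresentableWith.exists_flatBlock {𝕜 X : Type*} [RCLike 𝕜]
    [NormedAddCommGroup X] [NormedSpace 𝕜 X] {p : ℝ≥0∞} [Fact (1 ≤ p)] {K : ℝ}
    (h : CrudelyFinitelyRepresentableWith 𝕜 (lp (fun _ : ℕ => 𝕜) p) X K) (hK : 0 ≤ K)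
    (E : Submodule 𝕜 X) [FiniteDimensional 𝕜 E] {N : Submodule 𝕜 X} (hN : N.CoFG)
    (Ω : Type*) [Fintype Ω] :
    ∃ B : FlatBlock 𝕜 X Ω p.toReal⁻¹ (3 * K),
      (∀ c, B.incl c ∈ N) ∧ ∀ u ∈ E, B.coord u = 0 := by
  obtain ⟨M, hM, hEM⟩ := exists_cofg_norm_le_three_mul E
  obtain ⟨S, hS⟩ := h.exists_linearMap_of_cofg (hN.inf hM) Ω
  obtain ⟨P, hPS, hPE, hP⟩ := exists_coord_of_le_norm S E (C := 3 * K) fun c u hu =>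
    calc ‖c‖ ≤ K * ‖S c‖ := (hS c).2.1
      _ ≤ K * (3 * ‖S c - u‖) := by
        gcongr
        exact hEM _ (hS c).1.2 u hu
      _ = 3 * K * ‖S c - u‖ := by ring
  exact ⟨⟨S, P, hPS, hP, fun c => (hS c).2.2⟩, fun c => (hS c).1.1, hPE⟩

/-- A sequence of flat blocks in `X`, each annihilated by the coordinates of the others. -/
structure FlatBlocks (𝕜 X : Type*) [RCLike 𝕜] [NormedAddCommGroup X] [NormedSpace 𝕜 X]
    (Ω : ℕ → Type*) [∀ n, Fintype (Ω n)] (θ C : ℝ) where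
  block : ∀ n, FlatBlock 𝕜 X (Ω n) θ C
  coord_incl_of_ne : ∀ {m n}, m ≠ n → ∀ c, (block m).coord ((block n).incl c) = 0

theorem exists_seq_forall_lt {α : ℕ → Type*} (r : ∀ m n, α m → α n → Prop)
    (h : ∀ n (f : ∀ m : Fin n, α m), ∃ y, ∀ m : Fin n, r m n (f m) y) :
    ∃ f : ∀ n, α n, ∀ m n, m < n → r m n (f m) (f n) := by
  choose next hnext using h
  let f : ∀ n, α n := Nat.strongRec fun n ih => next n fun m => ih m m.2
  have hf n : f n = next n fun m => f m := Nat.strongRec_eq _ n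
  refine ⟨f, fun m n hmn => ?_⟩
  rw [hf n]
  exact hnext n (fun m => f m) ⟨m, hmn⟩

theorem CrudelyFinitelyRepresentableWith.nonempty_flatBlocks {𝕜 X : Type*} [RCLike 𝕜]
    [NormedAddCommGroup X] [NormedSpace 𝕜 X] {p : ℝ≥0∞} [Fact (1 ≤ p)] {K : ℝ}
    (h : CrudelyFinitelyRepresentableWith 𝕜 (lp (fun _ : ℕ => 𝕜) p) X K) (hK : 0 ≤ K)
    (Ω : ℕ → Type*) [∀ n, Fintype (Ω n)] :
    Nonempty (FlatBlocks 𝕜 X Ω p.toReal⁻¹ (3 * K)) := by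
  obtain ⟨B, hB⟩ := exists_seq_forall_lt
    (α := fun n => FlatBlock 𝕜 X (Ω n) p.toReal⁻¹ (3 * K))
    (fun m n b b' => (∀ c, b.coord (b'.incl c) = 0) ∧ ∀ c, b'.coord (b.incl c) = 0)
    fun n b => by
      obtain ⟨b', hN, hE⟩ := h.exists_flatBlock hK (⨆ m, LinearMap.range (b m).incl)
        (Submodule.CoFG.ker (LinearMap.pi fun m => (b m).coord.toLinearMap)) (Ω n)
      exact ⟨b', fun m => ⟨fun c => congrFun (LinearMap.mem_ker.1 (hN c)) m,
        fun c => hE _ (Submodule.mem_iSup_of_mem m ⟨c, rfl⟩)⟩⟩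
  refine ⟨⟨B, fun {m n} hmn c => ?_⟩⟩
  rcases lt_or_gt_of_ne hmn with hlt | hlt
  · exact (hB m n hlt).1 c
  · exact (hB n m hlt).2 c

section WeightedAverage

variable {𝕜 E F I J : Type*} [RCLike 𝕜] [NormedAddCommGroup E] [NormedSpace 𝕜 E]
  [NormedAddCommGroup F] [NormedSpace 𝕜 F] [Fintype I] [Fintype J]

/-- The average of the vectors `f i • u i`; the weights `f i` are unimodular in all applications. -/
noncomputable def weightedAvg (f : I → 𝕜) (u : I → E) : E :=
  (Fintype.card I : 𝕜)⁻¹ • ∑ i, f i • u i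

theorem weightedAvg_def (f : I → 𝕜) (u : I → E) :
    weightedAvg f u = ∑ i, ((Fintype.card I : 𝕜)⁻¹ * f i) • u i := by
  simp only [weightedAvg, Finset.smul_sum, smul_smul]

theorem weightedAvg_add (f : I → 𝕜) (u v : I → E) :
    weightedAvg f (fun i => u i + v i) = weightedAvg f u + weightedAvg f v := by
  simp only [weightedAvg, smul_add, Finset.sum_add_distrib]

theorem weightedAvg_sub (f : I → 𝕜) (u v : I → E) :
    weightedAvg f u - weightedAvg f v = weightedAvg f fun i => u i - v i := by
  simp only [weightedAvg, smul_sub, Finset.sum_sub_distrib]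

theorem map_weightedAvg (L : E →ₗ[𝕜] F) (f : I → 𝕜) (u : I → E) :
    L (weightedAvg f u) = weightedAvg f fun i => L (u i) := by
  simp only [weightedAvg, map_smul, map_sum]

theorem weightedAvg_apply {Ω : Type*} [Fintype Ω] (f : I → 𝕜) (u : I → Ω → 𝕜) (ω : Ω) :
    weightedAvg f u ω = (Fintype.card I : 𝕜)⁻¹ * ∑ i, f i * u i ω := by
  simp [weightedAvg]

theorem norm_weightedAvg_le [Nonempty I] {f : I → 𝕜} (hf : ∀ i, ‖f i‖ = 1) {u : I → E} {r : ℝ}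
    (hu : ∀ i, ‖u i‖ ≤ r) : ‖weightedAvg f u‖ ≤ r := by
  have hcard : (0 : ℝ) < Fintype.card I := by exact_mod_cast Fintype.card_pos
  rw [weightedAvg, norm_smul, norm_inv, RCLike.norm_natCast, inv_mul_le_iff₀ hcard]
  calc ‖∑ i, f i • u i‖ ≤ ∑ i, ‖f i • u i‖ := norm_sum_le _ _
    _ ≤ ∑ _i : I, r := by
      gcongr with i
      rw [norm_smul, hf, one_mul]
      exact hu i
    _ = Fintype.card I * r := by simp

theorem sum_norm_inv_card_mul_of_norm_eq_one [Nonempty I] {f : I → 𝕜} (hf : ∀ i, ‖f i‖ = 1) :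
    ∑ i, ‖(Fintype.card I : 𝕜)⁻¹ * f i‖ = 1 := by
  have hcard : (Fintype.card I : ℝ) ≠ 0 := by exact_mod_cast Fintype.card_ne_zero
  simp [hf, hcard]

/-- The family `u` is dominated by the family `v` up to a factor `A` and an error that is at most
`κ` times the `ℓ₁`-norm of the coefficients. -/
def AlmostDominated (𝕜 : Type*) [RCLike 𝕜] [NormedSpace 𝕜 E] (A κ : ℝ) (u v : I → E) : Prop :=
  ∀ c : I → 𝕜, ‖∑ i, c i • u i‖ ≤ A * ‖∑ i, c i • v i‖ + κ * ∑ i, ‖c i‖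

theorem AlmostDominated.of_sumElim_left {A κ : ℝ} {u v : I → E} {u' v' : J → E}
    (h : AlmostDominated 𝕜 A κ (Sum.elim u u') (Sum.elim v v')) : AlmostDominated 𝕜 A κ u v :=
  fun c => by simpa using h (Sum.elim c 0)

theorem AlmostDominated.norm_weightedAvg_le [Nonempty I] {A κ : ℝ} {u v : I → E}
    (h : AlmostDominated 𝕜 A κ u v) {f : I → 𝕜} (hf : ∀ i, ‖f i‖ = 1) :
    ‖weightedAvg f u‖ ≤ A * ‖weightedAvg f v‖ + κ := by
  simpa only [weightedAvg_def, sum_norm_inv_card_mul_of_norm_eq_one hf, mul_one] using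
    h fun i => (Fintype.card I : 𝕜)⁻¹ * f i

theorem AlmostDominated.norm_weightedAvg_sub_le [Nonempty I] [Nonempty J] {A κ : ℝ}
    {u v : I → E} {u' v' : J → E}
    (h : AlmostDominated 𝕜 A κ (Sum.elim u u') (Sum.elim v v')) {f : I → 𝕜} {g : J → 𝕜}
    (hf : ∀ i, ‖f i‖ = 1) (hg : ∀ j, ‖g j‖ = 1) :
    ‖weightedAvg f u - weightedAvg g u'‖ ≤
      A * ‖weightedAvg f v - weightedAvg g v'‖ + 2 * κ := by
  have hc := h (Sum.elim (fun i => (Fintype.card I : 𝕜)⁻¹ * f i)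
    fun j => -((Fintype.card J : 𝕜)⁻¹ * g j))
  simp only [Fintype.sum_sum_type, Sum.elim_inl, Sum.elim_inr, neg_smul, Finset.sum_neg_distrib,
    norm_neg, sum_norm_inv_card_mul_of_norm_eq_one hf, sum_norm_inv_card_mul_of_norm_eq_one hg,
    ← sub_eq_add_neg, ← weightedAvg_def] at hc
  linarith

end WeightedAverage

namespace FlatBlock

variable {𝕜 X Ω : Type*} [RCLike 𝕜] [NormedAddCommGroup X] [NormedSpace 𝕜 X] [Fintype Ω]
  {θ C : ℝ} (B : FlatBlock 𝕜 X Ω θ C)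

include B in
theorem const_nonneg [Nonempty Ω] : 0 ≤ C := by
  obtain ⟨ω⟩ := ‹Nonempty Ω›
  have h := B.norm_coord_apply_le (B.incl 1) ω
  rw [B.coord_incl, Pi.one_apply, norm_one] at h
  exact (pos_of_mul_pos_left (zero_lt_one.trans_le h) (norm_nonneg _)).le

theorem norm_coord_apply_le_of_le [Nonempty Ω] {v : X} {r : ℝ} (hv : ‖v‖ ≤ r) (ω : Ω) :
    ‖B.coord v ω‖ ≤ C * r :=
  (B.norm_coord_apply_le v ω).trans (mul_le_mul_of_nonneg_left hv B.const_nonneg)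

theorem norm_incl_le_of_norm_le {c : Ω → 𝕜} {η : ℝ} (hc : ‖c‖ ≤ η) :
    ‖B.incl c‖ ≤ η * (Fintype.card Ω : ℝ) ^ θ := by
  rw [mul_comm]
  exact (B.norm_incl_le c).trans (mul_le_mul_of_nonneg_left hc (by positivity))

/-- The functional sending `incl c` to the normalized bilinear pairing of `f` and `c`. -/
noncomputable def pairing (f : Ω → 𝕜) : X →ₗ[𝕜] 𝕜 :=
  (Fintype.card Ω : 𝕜)⁻¹ • ∑ ω, f ω • (LinearMap.proj ω ∘ₗ B.coord.toLinearMap)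

theorem pairing_apply (f : Ω → 𝕜) (v : X) : B.pairing f v = weightedAvg f (B.coord v) := by
  simp [pairing, weightedAvg]

theorem continuous_pairing (f : Ω → 𝕜) : Continuous (B.pairing f) := by
  simp only [funext (B.pairing_apply f), weightedAvg]
  fun_prop

theorem norm_pairing_le [Nonempty Ω] {f : Ω → 𝕜} (hf : ∀ ω, ‖f ω‖ = 1) (v : X) :
    ‖B.pairing f v‖ ≤ C * ‖v‖ := by
  rw [pairing_apply]
  exact norm_weightedAvg_le hf (B.norm_coord_apply_le v)

theorem weightedAvg_one_pairing {I : Type*} [Fintype I] (f : I → Ω → 𝕜) (u : I → X) :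
    weightedAvg (1 : I → 𝕜) (fun i => B.pairing (f i) (u i)) =
      weightedAvg (1 : Ω → 𝕜) fun ω => B.coord (weightedAvg (fun i => f i ω) u) ω := by
  simp only [pairing_apply, weightedAvg, Pi.one_apply, one_smul, map_smul, map_sum, Pi.smul_apply,
    Finset.sum_apply, Finset.smul_sum]
  rw [Finset.sum_comm]
  exact Finset.sum_congr rfl fun _ _ => Finset.sum_congr rfl fun _ _ => smul_comm _ _ _

end FlatBlock

namespace SignSystem

variable {𝕜 : Type*} [RCLike 𝕜] {I Ω : ℕ → Type*} [∀ n, Fintype (I n)] [∀ n, DecidableEq (I n)]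
  [∀ n, Fintype (Ω n)] [∀ n, Nonempty (Ω n)] (S : SignSystem 𝕜 I Ω)

theorem eta_nonneg (n : ℕ) : 0 ≤ S.η n :=
  (norm_nonneg _).trans (S.avg_b_a n true (Classical.arbitrary _) (Classical.arbitrary _))

theorem norm_weightedAvg_b_a_le (n : ℕ) (t : Bool) (ω : Ω (n + 1)) :
    ‖weightedAvg (fun i => S.b n t i ω) (S.a n)‖ ≤ S.η n :=
  (pi_norm_le_iff_of_nonempty _).2 fun ω' => by
    rw [weightedAvg_apply]
    exact S.avg_b_a n t ω ω'

theorem norm_weightedAvg_a_b_le (n : ℕ) (t : Bool) (ω : Ω n) :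
    ‖weightedAvg (fun i => S.a n i ω) (S.b n t)‖ ≤ S.η n :=
  (pi_norm_le_iff_of_nonempty _).2 fun ω' => by
    simp only [weightedAvg_apply, mul_comm (S.a n _ ω)]
    exact S.avg_b_a n t ω' ω

theorem norm_weightedAvg_b_b_le (n : ℕ) {t t' : Bool} (h : t ≠ t') (ω : Ω (n + 1)) :
    ‖weightedAvg (fun i => S.b n t i ω) (S.b n t')‖ ≤ S.η n :=
  (pi_norm_le_iff_of_nonempty _).2 fun ω' => by
    rw [weightedAvg_apply]
    exact S.avg_b_b n t t' ω ω' h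

theorem norm_weightedAvg_b_b_sub_le (n : ℕ) (t : Bool) (ω : Ω (n + 1)) :
    ‖weightedAvg (fun i => S.b n t i ω) (S.b n t) -
      weightedAvg (fun i => S.a (n + 1) i ω) (S.a (n + 1))‖ ≤ S.η n :=
  (pi_norm_le_iff_of_nonempty _).2 fun ω' => by
    rw [Pi.sub_apply, weightedAvg_apply, weightedAvg_apply]
    exact S.avg_sub n t ω ω'

end SignSystem

section ChainSpace

variable {𝕜 X : Type*} [RCLike 𝕜] [NormedAddCommGroup X] [NormedSpace 𝕜 X] {I Ω : ℕ → Type*}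
  [∀ n, Fintype (I n)] [∀ n, DecidableEq (I n)] [∀ n, Fintype (Ω n)] {θ C : ℝ}
  (S : SignSystem 𝕜 I Ω) (e : FlatBlocks 𝕜 X Ω θ C)

/-- The spanning vectors of `chainSpace`: the `n`-th digit of `x` selects the functions used to
continue level `n` into the block at level `n + 1`. -/
def chainVec (x : ℕ → Bool) (n : ℕ) (i : I n) : X :=
  (e.block n).incl (S.a n i) + (e.block (n + 1)).incl (S.b n (x n) i)

/-- The closed subspace attached to the point `x` of the Cantor space. -/
def chainSpace (x : ℕ → Bool) : Submodule 𝕜 X :=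
  (Submodule.span 𝕜 (Set.range fun q : Σ n, I n => chainVec S e x q.1 q.2)).topologicalClosure

/-- The `i`-th coefficient at level `n`, computed in the block at level `n`. -/
noncomputable def leftCoord (n : ℕ) (i : I n) : X →ₗ[𝕜] 𝕜 :=
  (e.block n).pairing (S.a n i)

/-- The `i`-th coefficient at level `n`, computed in the block at level `n + 1`, for the digit
`t`. -/
noncomputable def rightCoord (n : ℕ) (t : Bool) (i : I n) : X →ₗ[𝕜] 𝕜 :=
  (e.block (n + 1)).pairing (S.b n t i)

/-- The normalized trace, at level `n`, of the operator sending the spanning vectors to `u`. -/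
noncomputable def levelTrace (n : ℕ) (u : I n → X) : 𝕜 :=
  weightedAvg (1 : I n → 𝕜) fun i => leftCoord S e n i (u i)

theorem chainVec_mem_chainSpace (x : ℕ → Bool) (n : ℕ) (i : I n) :
    chainVec S e x n i ∈ chainSpace S e x :=
  Submodule.le_topologicalClosure _ (Submodule.subset_span ⟨⟨n, i⟩, rfl⟩)

theorem chainSpace_le {x : ℕ → Bool} {W : Submodule 𝕜 X} (hW : IsClosed (W : Set X))
    (h : ∀ n i, chainVec S e x n i ∈ W) : chainSpace S e x ≤ W :=
  Submodule.topologicalClosure_minimal _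
    (Submodule.span_le.2 (Set.range_subset_iff.2 fun q => h q.1 q.2)) hW

theorem chainVec_congr {x y : ℕ → Bool} {n : ℕ} (h : x n = y n) (i : I n) :
    chainVec S e x n i = chainVec S e y n i := by
  rw [chainVec, chainVec, h]

theorem coord_chainVec_self (x : ℕ → Bool) (n : ℕ) (i : I n) :
    (e.block n).coord (chainVec S e x n i) = S.a n i := by
  rw [chainVec, map_add, (e.block n).coord_incl, e.coord_incl_of_ne (by simp), add_zero]

theorem coord_chainVec_succ (x : ℕ → Bool) (n : ℕ) (i : I n) :
    (e.block (n + 1)).coord (chainVec S e x n i) = S.b n (x n) i := by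
  rw [chainVec, map_add, (e.block (n + 1)).coord_incl, e.coord_incl_of_ne (by simp), zero_add]

theorem coord_chainVec_of_ne (x : ℕ → Bool) {k n : ℕ} (h : k ≠ n) (h' : k ≠ n + 1) (i : I n) :
    (e.block k).coord (chainVec S e x n i) = 0 := by
  rw [chainVec, map_add, e.coord_incl_of_ne h, e.coord_incl_of_ne h', zero_add]

theorem leftCoord_chainVec_of_ne (x : ℕ → Bool) {n m : ℕ} (h : n ≠ m) (i : I n) (j : I m) :
    leftCoord S e n i (chainVec S e x m j) = 0 := by
  rw [leftCoord, FlatBlock.pairing_apply, weightedAvg]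
  by_cases h' : n = m + 1
  · subst h'
    simp only [coord_chainVec_succ, smul_eq_mul, mul_comm (S.a _ _ _), S.sum_b_a, mul_zero]
  · simp [coord_chainVec_of_ne S e x h h']

theorem rightCoord_chainVec_of_ne (x : ℕ → Bool) {n m : ℕ} (h : n ≠ m) (i : I n) (j : I m) :
    rightCoord S e n (x n) i (chainVec S e x m j) = 0 := by
  rw [rightCoord, FlatBlock.pairing_apply, weightedAvg]
  by_cases h' : n + 1 = m
  · subst h'
    simp only [coord_chainVec_self, smul_eq_mul, S.sum_b_a, mul_zero]
  · simp [coord_chainVec_of_ne S e x h' (by omega)]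

theorem weightedAvg_chainVec (x : ℕ → Bool) (n : ℕ) (f : I n → 𝕜) :
    weightedAvg f (chainVec S e x n) = (e.block n).incl (weightedAvg f (S.a n)) +
      (e.block (n + 1)).incl (weightedAvg f (S.b n (x n))) := by
  rw [map_weightedAvg, map_weightedAvg, ← weightedAvg_add]
  rfl

theorem levelTrace_eq_left (n : ℕ) (u : I n → X) : levelTrace S e n u =
    weightedAvg (1 : Ω n → 𝕜) fun ω =>
      (e.block n).coord (weightedAvg (fun i => S.a n i ω) u) ω :=
  (e.block n).weightedAvg_one_pairing (S.a n) u

variable [∀ n, Nonempty (Ω n)]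

theorem leftCoord_chainVec (x : ℕ → Bool) (n : ℕ) (i j : I n) :
    leftCoord S e n i (chainVec S e x n j) = if i = j then 1 else 0 := by
  rw [leftCoord, FlatBlock.pairing_apply, weightedAvg]
  simp [coord_chainVec_self, S.sum_a_a]

theorem rightCoord_chainVec (x : ℕ → Bool) (n : ℕ) (i j : I n) :
    rightCoord S e n (x n) i (chainVec S e x n j) = if i = j then 1 else 0 := by
  rw [rightCoord, FlatBlock.pairing_apply, weightedAvg]
  simp [coord_chainVec_succ, S.sum_b_b]

theorem leftCoord_eq_rightCoord {x : ℕ → Bool} (n : ℕ) (i : I n) {v : X}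
    (hv : v ∈ chainSpace S e x) : leftCoord S e n i v = rightCoord S e n (x n) i v := by
  have hclosed : IsClosed
      (LinearMap.eqLocus (leftCoord S e n i) (rightCoord S e n (x n) i) : Set X) :=
    isClosed_eq (FlatBlock.continuous_pairing _ _) (FlatBlock.continuous_pairing _ _)
  refine chainSpace_le S e hclosed (fun m j => ?_) hv
  rw [LinearMap.mem_eqLocus]
  rcases eq_or_ne n m with rfl | hnm
  · rw [leftCoord_chainVec, rightCoord_chainVec]
  · rw [leftCoord_chainVec_of_ne S e x hnm, rightCoord_chainVec_of_ne S e x hnm]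

theorem levelTrace_eq_right {x : ℕ → Bool} (n : ℕ) {u : I n → X}
    (hu : ∀ i, u i ∈ chainSpace S e x) : levelTrace S e n u =
    weightedAvg (1 : Ω (n + 1) → 𝕜) fun ω =>
      (e.block (n + 1)).coord (weightedAvg (fun i => S.b n (x n) i ω) u) ω := by
  simp only [levelTrace, leftCoord_eq_rightCoord S e n _ (hu _)]
  exact (e.block (n + 1)).weightedAvg_one_pairing (S.b n (x n)) u

theorem norm_weightedAvg_chainVec_sub_le {x x' : ℕ → Bool} {n : ℕ} (hx : x n = x' n)
    (ω : Ω (n + 1)) :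
    ‖weightedAvg (fun i => S.b n (x n) i ω) (chainVec S e x' n) -
      weightedAvg (fun i => S.a (n + 1) i ω) (chainVec S e x' (n + 1))‖ ≤ S.error θ n := by
  have hregroup : ∀ p q r s : X, p + q - (r + s) = p + (q - r) - s := fun p q r s => by abel
  rw [weightedAvg_chainVec, weightedAvg_chainVec, hregroup, ← map_sub, hx]
  refine (norm_sub_le _ _).trans (add_le_add ((norm_add_le _ _).trans (add_le_add ?_ ?_)) ?_)
  · exact (e.block n).norm_incl_le_of_norm_le (S.norm_weightedAvg_b_a_le n _ ω)
  · exact (e.block (n + 1)).norm_incl_le_of_norm_le (S.norm_weightedAvg_b_b_sub_le n _ ω)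
  · exact (e.block (n + 2)).norm_incl_le_of_norm_le (S.norm_weightedAvg_a_b_le (n + 1) _ ω)

theorem norm_weightedAvg_chainVec_le {x x' : ℕ → Bool} {n : ℕ} (hx : x n ≠ x' n)
    (ω : Ω (n + 1)) :
    ‖weightedAvg (fun i => S.b n (x n) i ω) (chainVec S e x' n)‖ ≤ S.error θ n := by
  rw [weightedAvg_chainVec]
  refine le_add_of_le_of_nonneg ((norm_add_le _ _).trans (add_le_add ?_ ?_))
    (mul_nonneg (S.eta_nonneg _) (by positivity))
  · exact (e.block n).norm_incl_le_of_norm_le (S.norm_weightedAvg_b_a_le n _ ω)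
  · exact (e.block (n + 1)).norm_incl_le_of_norm_le (S.norm_weightedAvg_b_b_le n hx ω)

section Trace

variable [∀ n, Nonempty (I n)] {x x' : ℕ → Bool} {n : ℕ} {A κ : ℝ}

theorem norm_levelTrace_sub_le (hx : x n = x' n) {u : I n → X} {u' : I (n + 1) → X}
    (hu : ∀ i, u i ∈ chainSpace S e x) (hA : 0 ≤ A)
    (h : AlmostDominated 𝕜 A κ (Sum.elim u u')
      (Sum.elim (chainVec S e x' n) (chainVec S e x' (n + 1)))) :
    ‖levelTrace S e n u - levelTrace S e (n + 1) u'‖ ≤ C * (A * S.error θ n + 2 * κ) := by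
  rw [levelTrace_eq_right S e n hu, levelTrace_eq_left, weightedAvg_sub]
  refine norm_weightedAvg_le (fun _ => norm_one) fun ω => ?_
  rw [← Pi.sub_apply, ← map_sub]
  refine (e.block (n + 1)).norm_coord_apply_le_of_le ?_ ω
  refine (h.norm_weightedAvg_sub_le (fun i => S.norm_b n _ i ω)
    fun i => S.norm_a (n + 1) i ω).trans ?_
  gcongr
  exact norm_weightedAvg_chainVec_sub_le S e hx ω

theorem norm_levelTrace_le (hx : x n ≠ x' n) {u : I n → X} (hu : ∀ i, u i ∈ chainSpace S e x)
    (hA : 0 ≤ A) (h : AlmostDominated 𝕜 A κ u (chainVec S e x' n)) :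
    ‖levelTrace S e n u‖ ≤ C * (A * S.error θ n + κ) := by
  rw [levelTrace_eq_right S e n hu]
  refine norm_weightedAvg_le (fun _ => norm_one) fun ω => ?_
  refine (e.block (n + 1)).norm_coord_apply_le_of_le ?_ ω
  refine (h.norm_weightedAvg_le fun i => S.norm_b n _ i ω).trans ?_
  gcongr
  exact norm_weightedAvg_chainVec_le S e hx ω

theorem norm_levelTrace_le_sum {M N : ℕ} (hMN : M ≤ N) (hlt : ∀ n < N, x n = x' n)
    (hx : x N ≠ x' N) {u : ∀ n, I n → X} (hu : ∀ n ≤ N, ∀ i, u n i ∈ chainSpace S e x)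
    (hA : 0 ≤ A) (hκ : 0 ≤ κ)
    (h : ∀ n ≤ N, AlmostDominated 𝕜 A κ (Sum.elim (u n) (u (n + 1)))
      (Sum.elim (chainVec S e x' n) (chainVec S e x' (n + 1)))) :
    ‖levelTrace S e M (u M)‖ ≤ ∑ n ∈ Finset.Icc M N, C * (A * S.error θ n + 2 * κ) := by
  have hC : 0 ≤ C := (e.block 0).const_nonneg
  induction hMN using Nat.decreasingInduction with
  | self =>
    rw [Finset.Icc_self, Finset.sum_singleton]
    refine (norm_levelTrace_le S e hx (hu N le_rfl) hA (h N le_rfl).of_sumElim_left).trans ?_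
    gcongr
    linarith
  | of_succ M hM ih =>
    rw [← Finset.insert_Icc_succ_left_eq_Icc hM.le, Finset.sum_insert (by simp)]
    exact norm_le_norm_sub_add _ (levelTrace S e (M + 1) (u (M + 1))) |>.trans
      (add_le_add (norm_levelTrace_sub_le S e (hlt M hM) (hu M hM.le) hA (h M hM.le)) ih)

theorem norm_one_sub_levelTrace_le {u : I n → X} (hu : ∀ i, ‖u i - chainVec S e x n i‖ ≤ κ) :
    ‖1 - levelTrace S e n u‖ ≤ C * κ := by
  have htrace : (1 : 𝕜) = levelTrace S e n (chainVec S e x n) := by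
    simp [levelTrace, weightedAvg, leftCoord_chainVec]
  rw [htrace, levelTrace, levelTrace, weightedAvg_sub]
  refine norm_weightedAvg_le (fun _ => norm_one) fun i => ?_
  rw [← map_sub]
  refine ((e.block n).norm_pairing_le (S.norm_a n i) _).trans
    (mul_le_mul_of_nonneg_left ?_ (e.block n).const_nonneg)
  rw [norm_sub_rev]
  exact hu i

end Trace

end ChainSpace

section Meagre

theorem eventually_apply_eq {ι : Type*} {α : ι → Type*} [∀ i, TopologicalSpace (α i)]
    [∀ i, DiscreteTopology (α i)] (x : ∀ i, α i) (i : ι) : ∀ᶠ y in nhds x, y i = x i :=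
  (continuous_apply i).continuousAt.eventually_mem ((isOpen_discrete {x i}).mem_nhds rfl)

/-- The sequence starting with the finite sequence `u` and continuing as `z`. -/
def splice {l : ℕ} (u : Fin l → Bool) (z : ℕ → Bool) (i : ℕ) : Bool :=
  if h : i < l then u ⟨i, h⟩ else z i

theorem continuous_splice {l : ℕ} (u : Fin l → Bool) : Continuous (splice u) := by
  refine continuous_pi fun i => ?_
  unfold splice
  split
  · exact continuous_const
  · exact continuous_apply i

theorem splice_splice {l : ℕ} {u : Fin l → Bool} {x : ℕ → Bool} (h : ∀ i : Fin l, x i = u i)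
    (v : Fin l → Bool) : splice u (splice v x) = x := by
  funext i
  by_cases hi : i < l
  · simpa [splice, hi] using (h ⟨i, hi⟩).symm
  · simp [splice, hi]

theorem isOpenMap_splice {l : ℕ} (u : Fin l → Bool) : IsOpenMap (splice u) := by
  intro U hU
  refine isOpen_iff_mem_nhds.2 ?_
  rintro _ ⟨z, hz, rfl⟩
  have hprefix : ∀ᶠ x in nhds (splice u z), ∀ i : Fin l, x i = u i :=
    Filter.eventually_all.2 fun i =>
      (eventually_apply_eq (splice u z) i).mono fun x hx => hx.trans (by simp [splice])
  have htail : ∀ᶠ x in nhds (splice u z), splice (fun i : Fin l => z i) x ∈ U :=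
    (hU.preimage (continuous_splice _)).mem_nhds (by
      rwa [Set.mem_preimage, splice_splice fun _ => rfl])
  filter_upwards [hprefix, htail] with x hx hxU
  exact ⟨_, hxU, splice_splice hx _⟩

theorem exists_continuous_of_blocks {l : ℕ → ℕ} (hl : StrictMono l) (c : ℕ → Bool → ℕ → Bool) :
    ∃ f : (ℕ → Bool) → ℕ → Bool, Continuous f ∧
      (∀ x y, EventualAgreement x y → EventualAgreement (f x) (f y)) ∧
      ∀ x n, ∀ i ∈ Set.Ico (l n) (l (n + 1)), f x i = c n (x n) i := by
  let block : ℕ → ℕ := fun i => Nat.findGreatest (fun n => l n ≤ i) i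
  have block_eq : ∀ n, ∀ i ∈ Set.Ico (l n) (l (n + 1)), block i = n := fun n i hi =>
    Nat.findGreatest_eq_iff.2 ⟨hl.le_apply.trans hi.1, fun _ => hi.1, fun m hm _ =>
      not_le.2 (hi.2.trans_le (hl.monotone hm))⟩
  refine ⟨fun x i => c (block i) (x (block i)) i, ?_, ?_, fun x n i hi => by
    simp only [block_eq n i hi]⟩
  · exact continuous_pi fun i =>
      (continuous_of_discreteTopology (f := fun t => c (block i) t i)).comp (continuous_apply _)
  · rintro x y ⟨N, hN⟩
    refine ⟨l N, fun i hi => ?_⟩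
    have hblock : N ≤ block i := Nat.le_findGreatest (hl.le_apply.trans hi) hi
    simp only [hN _ hblock]

theorem exists_cylinder_subset_of_mem_nhds {x : ℕ → Bool} {U : Set (ℕ → Bool)}
    (hU : U ∈ nhds x) : ∃ l, PiNat.cylinder x l ⊆ U := by
  obtain ⟨_, ⟨x', l, rfl⟩, hx, hl⟩ :=
    (PiNat.isTopologicalBasis_cylinders fun _ => Bool).mem_nhds_iff.1 hU
  exact ⟨l, PiNat.mem_cylinder_iff_eq.1 hx ▸ hl⟩

theorem exists_cylinder_prod_subset_of_mem_nhds {x y : ℕ → Bool}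
    {U : Set ((ℕ → Bool) × (ℕ → Bool))} (hU : U ∈ nhds (x, y)) :
    ∃ l, PiNat.cylinder x l ×ˢ PiNat.cylinder y l ⊆ U := by
  obtain ⟨V, hV, W, hW, hVW⟩ := mem_nhds_prod_iff.1 hU
  obtain ⟨l, hl⟩ := exists_cylinder_subset_of_mem_nhds hV
  obtain ⟨l', hl'⟩ := exists_cylinder_subset_of_mem_nhds hW
  exact ⟨max l l', (Set.prod_mono ((PiNat.cylinder_anti x (le_max_left l l')).trans hl)
    ((PiNat.cylinder_anti y (le_max_right l l')).trans hl')).trans hVW⟩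

theorem exists_segments_of_dense {G : Set ((ℕ → Bool) × (ℕ → Bool))} (hG : IsOpen G)
    (hd : Dense G) (l : ℕ) : ∃ l' > l, ∃ a b : ℕ → Bool, ∀ x y,
      (∀ i ∈ Set.Ico l l', x i = a i) → (∀ i ∈ Set.Ico l l', y i = b i) → (x, y) ∈ G := by
  have hcont : ∀ q : (Fin l → Bool) × (Fin l → Bool),
      Continuous (Prod.map (splice q.1) (splice q.2)) := fun q =>
    (continuous_splice q.1).prodMap (continuous_splice q.2)
  have hopen : IsOpen (⋂ q : (Fin l → Bool) × (Fin l → Bool),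
      Prod.map (splice q.1) (splice q.2) ⁻¹' G) :=
    isOpen_iInter_of_finite fun q => hG.preimage (hcont q)
  obtain ⟨⟨a, b⟩, hab⟩ := (dense_iInter_of_isOpen (fun q => hG.preimage (hcont q)) fun q =>
    hd.preimage ((isOpenMap_splice q.1).prodMap (isOpenMap_splice q.2))).nonempty
  obtain ⟨l', hl'⟩ := exists_cylinder_prod_subset_of_mem_nhds (hopen.mem_nhds hab)
  refine ⟨max (l + 1) l', by omega, a, b, fun x y hx hy => ?_⟩
  have hcylinder : ∀ z c : ℕ → Bool, (∀ i ∈ Set.Ico l (max (l + 1) l'), z i = c i) →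
      splice (fun i : Fin l => c i) z ∈ PiNat.cylinder c l' := by
    intro z c hz i hi
    by_cases hil : i < l
    · simp [splice, hil]
    · simpa [splice, hil] using hz i ⟨not_lt.1 hil, lt_max_of_lt_right hi⟩
  have hmem := Set.mem_iInter.1 (hl' (Set.mk_mem_prod (hcylinder x a hx) (hcylinder y b hy)))
    (fun i => x i, fun i => y i)
  rwa [Set.mem_preimage, Prod.map_apply, splice_splice fun _ => rfl,
    splice_splice fun _ => rfl] at hmem

theorem exists_antitone_of_isMeagre {α : Type*} [TopologicalSpace α] [BaireSpace α] {s : Set α}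
    (hs : IsMeagre s) : ∃ G : ℕ → Set α, (∀ n, IsOpen (G n)) ∧ (∀ n, Dense (G n)) ∧
      Antitone G ∧ ∀ q ∈ s, ∃ n, q ∉ G n := by
  obtain ⟨t, hts, htG, htd⟩ := mem_residual.1 hs
  obtain ⟨f, hf, rfl⟩ := isGδ_iff_eq_iInter_nat.1 htG
  refine ⟨fun n => ⋂ k ∈ Set.Iic n, f k, fun n => (Set.finite_Iic n).isOpen_biInter fun k _ => hf k,
    fun n => htd.mono fun q hq => Set.mem_iInter₂.2 fun k _ => Set.mem_iInter.1 hq k,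
    fun m n hmn => Set.biInter_mono (Set.Iic_subset_Iic.2 hmn) fun _ _ => subset_rfl,
    fun q hq => ?_⟩
  by_contra! hG
  exact hts (Set.mem_iInter.2 fun n => Set.mem_iInter₂.1 (hG n) n (Set.self_mem_Iic)) hq

theorem exists_continuous_eventualAgreement_of_isMeagre {R : (ℕ → Bool) → (ℕ → Bool) → Prop}
    (hR : IsMeagre {q : (ℕ → Bool) × (ℕ → Bool) | R q.1 q.2}) (hsymm : ∀ x y, R x y → R y x) :
    ∃ f : (ℕ → Bool) → ℕ → Bool, Continuous f ∧
      (∀ x y, EventualAgreement x y → EventualAgreement (f x) (f y)) ∧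
      ∀ x y, R (f x) (f y) → EventualAgreement x y := by
  obtain ⟨G, hopen, hdense, hanti, hG⟩ := exists_antitone_of_isMeagre hR
  choose L hL a b hab using fun n => exists_segments_of_dense (hopen n) (hdense n)
  let l : ℕ → ℕ := fun n => Nat.rec 0 L n
  obtain ⟨f, hf, hfE, hfl⟩ := exists_continuous_of_blocks (l := l)
    (strictMono_nat_of_lt_succ fun n => hL n (l n))
    fun n t => bif t then b n (l n) else a n (l n)
  refine ⟨f, hf, hfE, fun x y hxy => ?_⟩
  obtain ⟨k, hk⟩ := hG (f x, f y) hxy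
  obtain ⟨k', hk'⟩ := hG (f y, f x) (hsymm _ _ hxy)
  refine ⟨max k k', fun n hn => ?_⟩
  have hk : (f x, f y) ∉ G n := fun h => hk (hanti ((le_max_left _ _).trans hn) h)
  have hk' : (f y, f x) ∉ G n := fun h => hk' (hanti ((le_max_right _ _).trans hn) h)
  cases hx : x n <;> cases hy : y n
  · rfl
  · exact absurd (hab n (l n) _ _ (fun i hi => by simp [hfl x n i hi, hx])
      fun i hi => by simp [hfl y n i hi, hy]) hk
  · exact absurd (hab n (l n) _ _ (fun i hi => by simp [hfl y n i hi, hy])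
      fun i hi => by simp [hfl x n i hi, hx]) hk'
  · rfl

end Meagre

section Domination

variable {𝕜 E I : Type*} [RCLike 𝕜] [NormedAddCommGroup E] [NormedSpace 𝕜 E] [Fintype I]

theorem AlmostDominated.of_norm_sub_le {κ : ℝ} {u v : I → E} (h : ∀ i, ‖v i - u i‖ ≤ κ) :
    AlmostDominated 𝕜 1 κ u v := fun c =>
  calc ‖∑ i, c i • u i‖ ≤ ‖∑ i, c i • v i‖ + ‖∑ i, c i • v i - ∑ i, c i • u i‖ :=
        norm_le_norm_add_norm_sub _ _
    _ ≤ 1 * ‖∑ i, c i • v i‖ + κ * ∑ i, ‖c i‖ := by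
      rw [one_mul, ← Finset.sum_sub_distrib, Finset.mul_sum]
      gcongr
      refine norm_sum_le_of_le _ fun i _ => ?_
      rw [← smul_sub, norm_smul, mul_comm]
      gcongr
      exact h i

theorem AlmostDominated.of_opNorm_le {K : ℝ} {Y Z : Submodule 𝕜 E} {T : Y →L[𝕜] Z}
    (hT : ‖T‖ ≤ K) (y : I → Y) :
    AlmostDominated 𝕜 K 0 (fun i => (T (y i) : E)) (fun i => (y i : E)) := fun c => by
  simpa using T.le_of_opNorm_le hT (∑ i, c i • y i)

theorem AlmostDominated.trans {A B κ κ' : ℝ} (hA : 0 ≤ A) {u v w : I → E}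
    (h : AlmostDominated 𝕜 A κ u v) (h' : AlmostDominated 𝕜 B κ' v w) :
    AlmostDominated 𝕜 (A * B) (A * κ' + κ) u w := fun c =>
  calc ‖∑ i, c i • u i‖ ≤ A * ‖∑ i, c i • v i‖ + κ * ∑ i, ‖c i‖ := h c
    _ ≤ A * (B * ‖∑ i, c i • w i‖ + κ' * ∑ i, ‖c i‖) + κ * ∑ i, ‖c i‖ := by
      gcongr
      exact h' c
    _ = A * B * ‖∑ i, c i • w i‖ + (A * κ' + κ) * ∑ i, ‖c i‖ := by ring

theorem AlmostDominated.of_opNorm_le_of_norm_sub_le {K κ : ℝ} {Y Z Y' Z' : Submodule 𝕜 E}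
    {T : Y →L[𝕜] Z} {V : Z' →L[𝕜] Y'} (hT : ‖T‖ ≤ K) (hV : ‖V‖ ≤ K) {y : I → Y} {z : I → Z'}
    (h : ∀ i, ‖(T (y i) : E) - z i‖ ≤ κ) :
    AlmostDominated 𝕜 (K ^ 2) (K * κ) (fun i => (V (z i) : E)) fun i => (y i : E) := by
  have hK : 0 ≤ K := (norm_nonneg _).trans hT
  convert (of_opNorm_le hV z).trans hK ((of_norm_sub_le h).trans zero_le_one (of_opNorm_le hT y))
    using 1 <;> ring

end Domination

theorem sum_Icc_add_le {a : ℕ → ℝ} {b r : ℝ} {M N : ℕ}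
    (ha : ∑ n ∈ Finset.Icc M N, a n ≤ r) (hb : 0 ≤ b) :
    ∑ n ∈ Finset.Icc M N, (a n + b) ≤ r + (N + 1) * b := by
  have hcard : ((Finset.Icc M N).card : ℝ) ≤ N + 1 := by
    rw [Nat.card_Icc]
    exact_mod_cast Nat.sub_le _ _
  rw [Finset.sum_add_distrib, Finset.sum_const, nsmul_eq_mul]
  gcongr

theorem exists_forall_mul_sum_Icc_le {a : ℕ → ℝ} (ha : Summable a) (c : ℝ) {r : ℝ} (hr : 0 < r) :
    ∃ M, ∀ N, c * ∑ n ∈ Finset.Icc M N, a n ≤ r := by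
  obtain ⟨s, hs⟩ := summable_iff_vanishing_norm.1 (ha.mul_left c) r hr
  refine ⟨s.sup id + 1, fun N => ?_⟩
  rw [Finset.mul_sum]
  refine (le_abs_self _).trans (hs _ (Finset.disjoint_left.2 fun n hn hns => ?_)).le
  exact (Nat.lt_of_succ_le (Finset.mem_Icc.1 hn).1).not_ge (Finset.le_sup (f := id) hns)

section Isomorphism

variable {𝕜 X : Type*} [RCLike 𝕜] [NormedAddCommGroup X] [NormedSpace 𝕜 X] {I Ω : ℕ → Type*}
  [∀ n, Fintype (I n)] [∀ n, DecidableEq (I n)] [∀ n, Fintype (Ω n)]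
  {θ C : ℝ} (S : SignSystem 𝕜 I Ω) (e : FlatBlocks 𝕜 X Ω θ C)

theorem eventually_mem_chainSpace {y : ℕ → Bool} {v : X}
    (hv : v ∈ Submodule.span 𝕜 (Set.range fun q : Σ n, I n => chainVec S e y q.1 q.2)) :
    ∀ᶠ y' in nhds y, v ∈ chainSpace S e y' := by
  induction hv using Submodule.span_induction with
  | mem v hv =>
    obtain ⟨q, rfl⟩ := hv
    filter_upwards [eventually_apply_eq y q.1] with y' hy'
    exact chainVec_congr S e hy' q.2 ▸ chainVec_mem_chainSpace S e y' q.1 q.2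
  | zero => exact .of_forall fun y' => zero_mem _
  | add v w _ _ hv hw => filter_upwards [hv, hw] with y' hv hw using add_mem hv hw
  | smul r v _ hv => filter_upwards [hv] with y' hv using Submodule.smul_mem _ r hv

theorem exists_approx_eventually_mem_chainSpace {y : ℕ → Bool} {v : ∀ n, I n → X}
    (hv : ∀ n i, v n i ∈ chainSpace S e y) {κ : ℝ} (hκ : 0 < κ) (N : ℕ) :
    ∃ w : ∀ n, I n → X, (∀ n ≤ N, ∀ i, ‖v n i - w n i‖ ≤ κ) ∧
      ∀ᶠ y' in nhds y, ∀ n i, w n i ∈ chainSpace S e y' := by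
  choose w hw hvw using fun n i => Metric.mem_closure_iff.1 (hv n i) κ hκ
  refine ⟨fun n i => if n ≤ N then w n i else 0, fun n hn i => ?_, ?_⟩
  · simpa only [if_pos hn, ← dist_eq_norm] using (hvw n i).le
  · filter_upwards [(Filter.eventually_all_finite (Set.finite_Iic N)).2 fun n _ =>
      Filter.eventually_all.2 fun i => eventually_mem_chainSpace S e (hw n i)] with y' hy' n i
    split_ifs with hn
    · exact hy' n hn i
    · exact zero_mem _

theorem isSeparable_iUnion_chainSpace :
    TopologicalSpace.IsSeparable (⋃ x, (chainSpace S e x : Set X)) := by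
  have hcount : TopologicalSpace.IsSeparable (Set.range fun q : Σ n, Bool × I n =>
      chainVec S e (fun _ => q.2.1) q.1 q.2.2) := (Set.countable_range _).isSeparable
  refine (hcount.span (R := 𝕜)).closure.mono (Set.iUnion_subset fun x => ?_)
  refine closure_mono (Submodule.span_mono (Set.range_subset_iff.2 fun q => ?_))
  exact ⟨⟨q.1, x q.1, q.2⟩, chainVec_congr S e rfl q.2⟩

/-- The spanning vector `chainVec S e x n i`, as an element of the space that it helps to span. -/
def chainGen (x : ℕ → Bool) (n : ℕ) (i : I n) : chainSpace S e x :=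
  ⟨chainVec S e x n i, chainVec_mem_chainSpace S e x n i⟩

/-- The spaces attached to `x` and `y` are isomorphic through an operator that, like its inverse,
has norm at most `K`, and that sends the spanning vectors of level `M` to within `ε` of `d`. For
fixed `K` and `M`, countably many such relations cover isomorphism. -/
def IsoNear (K : ℝ) (M : ℕ) (d : I M → X) (ε : ℝ) (x y : ℕ → Bool) : Prop :=
  ∃ T : chainSpace S e x ≃L[𝕜] chainSpace S e y,
    ‖(T : chainSpace S e x →L[𝕜] chainSpace S e y)‖ ≤ K ∧
    ‖(T.symm : chainSpace S e y →L[𝕜] chainSpace S e x)‖ ≤ K ∧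
    ∀ i, ‖(T (chainGen S e x M i) : X) - d i‖ ≤ ε

variable [∀ n, Nonempty (Ω n)] [∀ n, Nonempty (I n)]

theorem one_le_of_norm_apply_chainGen_sub_le {x x' y y' : ℕ → Bool} {K κ δ : ℝ} {M N : ℕ}
    (hMN : M ≤ N) (hlt : ∀ n < N, x n = x' n) (hx : x N ≠ x' N)
    {T : chainSpace S e x' →L[𝕜] chainSpace S e y'} (hT : ‖T‖ ≤ K)
    {U : chainSpace S e x ≃L[𝕜] chainSpace S e y}
    (hU : ‖(U.symm : chainSpace S e y →L[𝕜] chainSpace S e x)‖ ≤ K) (hκ : 0 ≤ κ)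
    {w : ∀ n, I n → chainSpace S e y}
    (hw : ∀ n ≤ N + 1, ∀ i, ‖(T (chainGen S e x' n i) : X) - w n i‖ ≤ κ)
    (hδ : ∀ i, ‖w M i - U (chainGen S e x M i)‖ ≤ δ) :
    1 ≤ C * (K * δ) + ∑ n ∈ Finset.Icc M N, C * (K ^ 2 * S.error θ n + 2 * (K * κ)) := by
  let u : ∀ n, I n → X := fun n i => (U.symm (w n i) : X)
  have hdom : ∀ n ≤ N, AlmostDominated 𝕜 (K ^ 2) (K * κ) (Sum.elim (u n) (u (n + 1)))
      (Sum.elim (chainVec S e x' n) (chainVec S e x' (n + 1))) := fun n hn => by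
    convert AlmostDominated.of_opNorm_le_of_norm_sub_le hT hU
      (y := Sum.elim (chainGen S e x' n) (chainGen S e x' (n + 1)))
      (z := Sum.elim (w n) (w (n + 1))) ?_ using 1
    · ext (i | i) <;> rfl
    · ext (i | i) <;> rfl
    · rintro (i | i)
      · exact hw n (by omega) i
      · exact hw (n + 1) (by omega) i
  have hclose : ∀ i, ‖u M i - chainVec S e x M i‖ ≤ K * δ := fun i =>
    calc ‖u M i - chainVec S e x M i‖
        = ‖U.symm (w M i - U (chainGen S e x M i))‖ := by
          rw [map_sub, U.symm_apply_apply]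
          rfl
      _ ≤ K * ‖w M i - U (chainGen S e x M i)‖ :=
          ContinuousLinearMap.le_of_opNorm_le
            (U.symm : chainSpace S e y →L[𝕜] chainSpace S e x) hU _
      _ ≤ K * δ := mul_le_mul_of_nonneg_left (hδ i) ((norm_nonneg _).trans hT)
  calc (1 : ℝ) = ‖(1 : 𝕜)‖ := norm_one.symm
    _ ≤ ‖1 - levelTrace S e M (u M)‖ + ‖levelTrace S e M (u M)‖ := by
      simpa using norm_add_le (1 - levelTrace S e M (u M)) (levelTrace S e M (u M))
    _ ≤ _ := add_le_add (norm_one_sub_levelTrace_le S e hclose)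
      (norm_levelTrace_le_sum S e hMN hlt hx (fun _ _ _ => Subtype.mem _) (sq_nonneg K)
        (mul_nonneg ((norm_nonneg _).trans hT) hκ) hdom)

variable {K ε : ℝ} {M : ℕ} {d : I M → X}

theorem not_isoNear_of_firstDiff {x x' y y' : ℕ → Bool} {κ : ℝ} {N : ℕ} (hκ : 0 ≤ κ)
    (hκK : C * K * (2 * N + 3) * κ < 1 / 4) (hε : C * K * ε ≤ 1 / 8)
    (hM : C * K ^ 2 * ∑ n ∈ Finset.Icc M N, S.error θ n ≤ 1 / 4) (hMN : M ≤ N)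
    (hlt : ∀ n < N, x n = x' n) (hx : x N ≠ x' N)
    {T : chainSpace S e x' ≃L[𝕜] chainSpace S e y'}
    (hT : ‖(T : chainSpace S e x' →L[𝕜] chainSpace S e y')‖ ≤ K)
    (hTd : ∀ i, ‖(T (chainGen S e x' M i) : X) - d i‖ ≤ ε)
    {w : ∀ n, I n → chainSpace S e y}
    (hw : ∀ n ≤ N + 1, ∀ i, ‖(T (chainGen S e x' n i) : X) - w n i‖ ≤ κ) :
    ¬ IsoNear S e K M d ε x y := by
  rintro ⟨U, -, hU, hUd⟩
  have hδ : ∀ i, ‖w M i - U (chainGen S e x M i)‖ ≤ κ + ε + ε := fun i => by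
    rw [← dist_eq_norm, Subtype.dist_eq]
    refine (dist_triangle4 _ (T (chainGen S e x' M i) : X) (d i) _).trans
      (add_le_add_three ?_ ?_ ?_)
    · rw [dist_comm, dist_eq_norm]
      exact hw M (by omega) i
    · rw [dist_eq_norm]
      exact hTd i
    · rw [dist_comm, dist_eq_norm]
      exact hUd i
  have hone := one_le_of_norm_apply_chainGen_sub_le S e hMN hlt hx hT hU hκ hw hδ
  have hCKκ : 0 ≤ C * K * κ :=
    mul_nonneg (mul_nonneg (e.block 0).const_nonneg ((norm_nonneg _).trans hT)) hκ
  have hsum : ∑ n ∈ Finset.Icc M N, C * (K ^ 2 * S.error θ n + 2 * (K * κ)) ≤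
      1 / 4 + (N + 1) * (2 * (C * K * κ)) := by
    rw [Finset.mul_sum] at hM
    convert sum_Icc_add_le hM (mul_nonneg zero_le_two hCKκ) using 2
    ring
  linarith

theorem IsoNear.eventually_not (hM : ∀ N, C * K ^ 2 * ∑ n ∈ Finset.Icc M N, S.error θ n ≤ 1 / 4)
    (hε : C * K * ε ≤ 1 / 8) {x y : ℕ → Bool} (h : IsoNear S e K M d ε x y) {N : ℕ}
    (hMN : M ≤ N) :
    ∀ᶠ q in nhds (Function.update x N (!x N), y), ¬ IsoNear S e K M d ε q.1 q.2 := by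
  obtain ⟨T, hT, -, hTd⟩ := h
  obtain ⟨κ, hκ, hκK⟩ := exists_pos_mul_lt (show (0 : ℝ) < 1 / 4 by norm_num)
    (C * K * (2 * N + 3))
  obtain ⟨w, hw, hwy⟩ := exists_approx_eventually_mem_chainSpace S e
    (v := fun n i => (T (chainGen S e x n i) : X)) (fun _ _ => Subtype.mem _) hκ (N + 1)
  have hprefix : ∀ᶠ x' in nhds (Function.update x N (!x N)),
      ∀ n ≤ N, x' n = Function.update x N (!x N) n :=
    (Filter.eventually_all_finite (Set.finite_Iic N)).2 fun n _ => eventually_apply_eq _ n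
  filter_upwards [hprefix.prod_nhds hwy] with q ⟨hx, hy⟩
  exact not_isoNear_of_firstDiff S e hκ.le hκK hε (hM N) hMN
    (fun n hn => by rw [hx n hn.le, Function.update_of_ne hn.ne])
    (by simp [hx N le_rfl]) hT hTd (w := fun n i => ⟨w n i, hy n i⟩) hw

theorem isNowhereDense_isoNear
    (hM : ∀ N, C * K ^ 2 * ∑ n ∈ Finset.Icc M N, S.error θ n ≤ 1 / 4) (hε : C * K * ε ≤ 1 / 8) :
    IsNowhereDense {q : (ℕ → Bool) × (ℕ → Bool) | IsoNear S e K M d ε q.1 q.2} := by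
  refine isNowhereDense_iff_forall_notMem_nhds.2 fun ⟨x, y⟩ hxy hnhds => ?_
  have hlim : Filter.Tendsto (fun N => (Function.update x N (!x N), y)) Filter.atTop
      (nhds (x, y)) := by
    refine Filter.Tendsto.prodMk_nhds (tendsto_pi_nhds.2 fun n => ?_) tendsto_const_nhds
    refine tendsto_const_nhds.congr' ?_
    filter_upwards [Filter.eventually_gt_atTop n] with N hN
    rw [Function.update_of_ne hN.ne]
  obtain ⟨N, hN, hMN⟩ :=
    ((hlim.eventually_mem hnhds).and (Filter.eventually_ge_atTop M)).exists
  exact (mem_closure_iff_frequently.1 hN) (IsoNear.eventually_not S e hM hε hxy hMN)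

theorem isMeagre_nonempty_chainSpace_equiv (hS : Summable (S.error θ)) :
    IsMeagre {q : (ℕ → Bool) × (ℕ → Bool) |
      Nonempty (chainSpace S e q.1 ≃L[𝕜] chainSpace S e q.2)} := by
  obtain ⟨D, hD, hdense⟩ := isSeparable_iUnion_chainSpace S e
  choose M hM using fun K : ℕ =>
    exists_forall_mul_sum_Icc_le hS (C * (K : ℝ) ^ 2) (show (0 : ℝ) < 1 / 4 by norm_num)
  choose ε hε hεK using fun K : ℕ =>
    exists_pos_mul_lt (show (0 : ℝ) < 1 / 8 by norm_num) (C * K)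
  have := hD.to_subtype
  refine IsMeagre.mono ?_ (isMeagre_iUnion fun k : Σ K : ℕ, I (M K) → D =>
    (isNowhereDense_isoNear S e (d := fun i => (k.2 i : X)) (hM k.1) (hεK k.1).le).isMeagre)
  rintro ⟨x, y⟩ ⟨T⟩
  obtain ⟨K, hK⟩ := exists_nat_ge (max ‖(T : chainSpace S e x →L[𝕜] chainSpace S e y)‖
    ‖(T.symm : chainSpace S e y →L[𝕜] chainSpace S e x)‖)
  choose d hd hTd using fun i => Metric.mem_closure_iff.1
    (hdense (Set.mem_iUnion_of_mem y (T (chainGen S e x (M K) i)).2)) (ε K) (hε K)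
  refine Set.mem_iUnion.2 ⟨⟨K, fun i => ⟨d i, hd i⟩⟩, T, (le_max_left _ _).trans hK,
    (le_max_right _ _).trans hK, fun i => ?_⟩
  rw [← dist_eq_norm]
  exact (hTd i).le

end Isomorphism

section Reduction

variable {𝕜 X : Type*} [RCLike 𝕜] [NormedAddCommGroup X] [NormedSpace 𝕜 X] {I Ω : ℕ → Type*}
  [∀ n, Fintype (I n)] [∀ n, DecidableEq (I n)] [∀ n, Fintype (Ω n)]
  {θ C : ℝ} (S : SignSystem 𝕜 I Ω) (e : FlatBlocks 𝕜 X Ω θ C)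

theorem isOpen_setOf_chainSpace_inter_nonempty {U : Set X} (hU : IsOpen U) :
    IsOpen {x | ((chainSpace S e x : Set X) ∩ U).Nonempty} := by
  refine isOpen_iff_mem_nhds.2 fun x hx => ?_
  obtain ⟨v, hv, hvU⟩ := (closure_inter_open_nonempty_iff hU).1 hx
  filter_upwards [eventually_mem_chainSpace S e hv] with y hy using ⟨v, hy, hvU⟩

/-- The operator replacing the spanning vectors of level below `N` for `x` by those for `y`. -/
noncomputable def exchange (x y : ℕ → Bool) (N : ℕ) : X →L[𝕜] X :=
  .id 𝕜 X + ∑ n ∈ Finset.range N, ∑ i,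
    (⟨leftCoord S e n i, FlatBlock.continuous_pairing _ _⟩ : X →L[𝕜] 𝕜).smulRight
      (chainVec S e y n i - chainVec S e x n i)

theorem exchange_apply (x y : ℕ → Bool) (N : ℕ) (v : X) :
    exchange S e x y N v = v + ∑ n ∈ Finset.range N, ∑ i,
      leftCoord S e n i v • (chainVec S e y n i - chainVec S e x n i) := by
  simp only [exchange, add_apply, ContinuousLinearMap.id_apply, sum_apply,
    ContinuousLinearMap.smulRight_apply]
  rfl

variable [∀ n, Nonempty (Ω n)] {x y : ℕ → Bool} {N : ℕ}

theorem exchange_chainVec (h : ∀ n, N ≤ n → x n = y n) (m : ℕ) (j : I m) :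
    exchange S e x y N (chainVec S e x m j) = chainVec S e y m j := by
  have hne : ∀ n ≠ m, ∑ i, leftCoord S e n i (chainVec S e x m j) •
      (chainVec S e y n i - chainVec S e x n i) = 0 := fun n hn => by
    simp [leftCoord_chainVec_of_ne S e x hn]
  rw [exchange_apply]
  by_cases hm : m < N
  · rw [Finset.sum_eq_single_of_mem m (Finset.mem_range.2 hm) fun n _ hn => hne n hn]
    simp [leftCoord_chainVec]
  · rw [Finset.sum_eq_zero fun n hn => hne n fun hnm => hm (hnm ▸ Finset.mem_range.1 hn), add_zero]
    exact chainVec_congr S e (h m (not_lt.1 hm)) j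

theorem exchange_mem (h : ∀ n, N ≤ n → x n = y n) {v : X} (hv : v ∈ chainSpace S e x) :
    exchange S e x y N v ∈ chainSpace S e y := by
  have hclosed : IsClosed
      ((chainSpace S e y).comap (exchange S e x y N).toLinearMap : Set X) :=
    (Submodule.isClosed_topologicalClosure _).preimage (exchange S e x y N).continuous
  refine chainSpace_le S e hclosed (fun n i => ?_) hv
  rw [Submodule.mem_comap, ContinuousLinearMap.coe_coe, exchange_chainVec S e h]
  exact chainVec_mem_chainSpace S e y n i

theorem exchange_exchange (h : ∀ n, N ≤ n → x n = y n) {v : X} (hv : v ∈ chainSpace S e x) :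
    exchange S e y x N (exchange S e x y N v) = v := by
  have hclosed : IsClosed (LinearMap.eqLocus
      ((exchange S e y x N).comp (exchange S e x y N)).toLinearMap LinearMap.id : Set X) :=
    isClosed_eq ((exchange S e y x N).comp (exchange S e x y N)).continuous continuous_id
  refine chainSpace_le S e hclosed (fun n i => ?_) hv
  rw [LinearMap.mem_eqLocus, ContinuousLinearMap.coe_coe, ContinuousLinearMap.comp_apply,
    exchange_chainVec S e h, exchange_chainVec S e fun n hn => (h n hn).symm]
  rfl

theorem nonempty_chainSpace_equiv_of_eventualAgreement (h : EventualAgreement x y) :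
    Nonempty (chainSpace S e x ≃L[𝕜] chainSpace S e y) := by
  obtain ⟨N, hxy⟩ := h
  have hyx : ∀ n, N ≤ n → y n = x n := fun n hn => (hxy n hn).symm
  exact ⟨.equivOfInverse
    ((exchange S e x y N).restrict fun v hv => exchange_mem S e hxy hv)
    ((exchange S e y x N).restrict fun v hv => exchange_mem S e hyx hv)
    (fun v => Subtype.ext (exchange_exchange S e hxy v.2))
    (fun v => Subtype.ext (exchange_exchange S e hyx v.2))⟩

variable [∀ n, Nonempty (I n)]

theorem not_finiteDimensional_chainSpace (x : ℕ → Bool) :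
    ¬ FiniteDimensional 𝕜 (chainSpace S e x) := by
  intro hfin
  let i : ∀ n, I n := fun n => Classical.arbitrary _
  have hindep : LinearIndependent 𝕜 fun n : ℕ => chainGen S e x n (i n) :=
    .of_pairwise_dual_eq_zero_one _
      (fun n => leftCoord S e n (i n) ∘ₗ (chainSpace S e x).subtype)
      (fun n m hnm => leftCoord_chainVec_of_ne S e x hnm _ _)
      fun n => (leftCoord_chainVec S e x n _ _).trans (if_pos rfl)
  have := hindep.finite_of_isNoetherian
  exact not_finite ℕ

/-- `chainSpace` as a point of the Effros Borel space of infinite-dimensional subspaces. -/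
def chainSB (x : ℕ → Bool) : SB 𝕜 X :=
  ⟨⟨chainSpace S e x, Submodule.isClosed_topologicalClosure _⟩,
    not_finiteDimensional_chainSpace S e x⟩

theorem measurable_chainSB : Measurable (chainSB S e) := by
  refine measurable_comap_iff.2 (measurable_generateFrom ?_)
  rintro _ ⟨U, hU, rfl⟩
  exact (isOpen_setOf_chainSpace_inter_nonempty S e hU).measurableSet

theorem borelReducible_of_summable_error (e : FlatBlocks 𝕜 X Ω θ C) (hS : Summable (S.error θ)) :
    BorelReducible EventualAgreement (SB.Isomorphic (𝕜 := 𝕜) (X := X)) := by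
  obtain ⟨f, hf, hfE, hfN⟩ := exists_continuous_eventualAgreement_of_isMeagre
    (R := fun x y => Nonempty (chainSpace S e x ≃L[𝕜] chainSpace S e y))
    (isMeagre_nonempty_chainSpace_equiv S e hS) fun x y ⟨T⟩ => ⟨T.symm⟩
  exact ⟨fun x => chainSB S e (f x), (measurable_chainSB S e).comp hf.measurable, fun x y =>
    ⟨fun h => nonempty_chainSpace_equiv_of_eventualAgreement S e (hfE x y h), hfN x y⟩⟩

end Reduction

theorem inv_toReal_lt_half {p : ℝ≥0∞} (hp : 2 < p) : p.toReal⁻¹ < 1 / 2 := by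
  rcases eq_or_ne p ∞ with rfl | htop
  · simp
  · rw [one_div]
    exact inv_strictAnti₀ two_pos (by simpa using (ENNReal.toReal_lt_toReal (by simp) htop).2 hp)

theorem crudelyFinitelyRepresentable_self (𝕜 X : Type*) [RCLike 𝕜] [NormedAddCommGroup X]
    [NormedSpace 𝕜 X] : CrudelyFinitelyRepresentable 𝕜 X X :=
  ⟨1, one_pos, fun F _ => ⟨F, .refl 𝕜 F, mul_le_one₀ ContinuousLinearMap.norm_id_le (norm_nonneg _)
    ContinuousLinearMap.norm_id_le⟩⟩

theorem separableSpace_lp (𝕜 : Type*) [RCLike 𝕜] {p : ℝ≥0∞} [Fact (1 ≤ p)] (hp : p ≠ ∞) :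
    TopologicalSpace.SeparableSpace (lp (fun _ : ℕ => 𝕜) p) := by
  have hcount : TopologicalSpace.IsSeparable
      (Set.range fun i : ℕ => (lp.single p i (1 : 𝕜) : lp (fun _ : ℕ => 𝕜) p)) :=
    (Set.countable_range _).isSeparable
  refine TopologicalSpace.isSeparable_univ_iff.1 ((hcount.span (R := 𝕜)).closure.mono fun f _ => ?_)
  refine mem_closure_of_tendsto (lp.hasSum_single hp f) (.of_forall fun s => ?_)
  refine Submodule.sum_mem _ fun i _ => ?_
  rw [← mul_one (f i), ← smul_eq_mul, lp.single_smul]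
  exact Submodule.smul_mem _ _ (Submodule.subset_span ⟨i, rfl⟩)

theorem mainTheorem7_general {𝕜 X : Type*} [RCLike 𝕜] [NormedAddCommGroup X] [NormedSpace 𝕜 X]
    {p : ℝ≥0∞} [Fact (1 ≤ p)] (hp : 2 < p)
    (h : CrudelyFinitelyRepresentable 𝕜 (lp (fun _ : ℕ => 𝕜) p) X) :
    BorelReducible EventualAgreement (SB.Isomorphic (𝕜 := 𝕜) (X := X)) := by
  obtain ⟨K, hK0, hK⟩ := h
  obtain ⟨S, hS⟩ := SignSystem.exists_summable_error 𝕜 (inv_toReal_lt_half hp)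
  obtain ⟨e⟩ := hK.nonempty_flatBlocks hK0.le fun n => Cube n × Cube 2
  exact borelReducible_of_summable_error S e hS

theorem mainTheorem7 {𝕜 : Type*} [RCLike 𝕜] (p : ℝ≥0∞) [Fact (1 ≤ p)] (hp : 2 < p) :
    (∀ (X : Type*) [NormedAddCommGroup X] [NormedSpace 𝕜 X] [CompleteSpace X]
        [TopologicalSpace.SeparableSpace X],
        CrudelyFinitelyRepresentable 𝕜 (lp (fun _ : ℕ => 𝕜) p) X → IsErgodicSpace 𝕜 X) ∧
      (p ≠ ∞ → IsErgodicSpace 𝕜 (lp (fun _ : ℕ => 𝕜) p)) :=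
  ⟨fun _ _ _ _ hsep h => ⟨hsep, mainTheorem7_general hp h⟩, fun hptop =>
    ⟨separableSpace_lp 𝕜 hptop, mainTheorem7_general hp (crudelyFinitelyRepresentable_self 𝕜 _)⟩⟩
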